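/- Let $G$ be a simply connected simple compact Lie group with real Lie algebra $\mathfrak g_{\mathbb R}$ and complexified Lie algebra $\mathfrak g$. Let $(\cdot,\cdot)$ be the rescaling of the Killing form of $\mathfrak g$ such that, for a Cartan subalgebra $\mathfrak h$, simple roots $\alpha_1,\dots,\alpha_r$ and Cartan matrix $(a_{ij})$, the induced form on $\mathfrak h^*$ satisfies $(\alpha_i,\alpha_j)=d_ia_{ij}$, where $d_1,\dots,d_r$ are the coprime positive integers for which $(d_ia_{ij})$ is symmetric. Let $\{x_k\}$ be a basis of $\mathfrak g_{\mathbb R}$ with $(x_k,x_l)=-\delta_{kl}$, and put $t=-\sum_k x_k\otimes x_k$. Let $\mathrm{Cl}(\mathfrak g)$ be the complex Clifford algebra generated by $\gamma(x)$, $x\in\mathfrak g$, with $\gamma(x)^2=(x,x)1$, with the $*$-structure such that $\gamma(x)^*=-\gamma(x)$ for $x\in\mathfrak g_{\mathbb R}$, and let $\widetilde{\mathrm{ad}}(x)=\frac14\sum_k\gamma(x_k)\gamma([x,x_k])$. Fix $q\in(0,1)$ and put $\hbar=\frac{\log q}{\pi i}$. For self-adjoint operators $A,B$ on a finite-dimensional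 Hilbert space, let $\Phi(A,B)$ be the operator with $G_0(x)=G_1(x)\Phi(A,B)$ for $x\in(0,1)$, where $G_0,G_1$ are the solutions on $(0,1)$ of $$G'(x)=\hbar\Big(\frac{A}{x}+\frac{B}{x-1}\Big)G(x)$$ such that $G_0(x)x^{-\hbar A}$ and $G_1(1-x)x^{-\hbar B}$ extend to holomorphic functions in the unit disc with value $1$ at $0$. The Drinfeld associator $\Phi=\Phi_{KZ}$ is given in a triple of finite-dimensional unitary representations by $\Phi(t_{12},t_{23})$, where $t_{12}=t\otimes1$ and $t_{23}=1\otimes t$ are evaluated in these representations. Then for all finite-dimensional unitary representations $\pi\colon G\to B(V)$ and $\pi'\colon G\to B(V')$ and every $*$-representation $s\colon \mathrm{Cl}(\mathfrak g)\to B(S)$ on a finite-dimensional Hilbert space, the operator $(\pi\otimes\pi'\otimes s\widetilde{\mathrm{ad}})(\Phi)$ on $V\otimes V'\otimes S$ exists and is uniquely determined by the above definition, and $$\big\|\big[(\pi\otimes\pi'\otimes s\gamma)(t_{23}),(\pi\otimes\pi'\otimes s\widetilde{\mathrm{ad}})(\Phi)\big]\big\|\le 6\,\|(\pi\otimes s\gamma)(t)\|.$$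 Taking $s$ faithful and the supremum over $\pi'$, this says that in $B(V)\otimes W^*(G)\otimes\mathrm{Cl}(\mathfrak g)$, where $W^*(G)$ is the group von Neumann algebra, $$\big\|\big[(\pi\otimes\iota\otimes\gamma)(t_{23}),(\pi\otimes\iota\otimes\widetilde{\mathrm{ad}})(\Phi)\big]\big\|\le 6\,\|(\pi\otimes\gamma)(t)\|.$$ -/

import Mathlib

open scoped TensorProduct Manifold ContDiff

noncomputable section

namespace KZ

/-! ### The Lie algebra, its invariant form, and the Clifford algebra -/

section LieAlgebra

variable (L : Type*) [LieRing L] [LieAlgebra ℝ L]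

/-- The complexification `𝔤 = ℂ ⊗ L` of the real Lie algebra `L`. -/
abbrev Cplx : Type _ :=
  @TensorProduct ℝ _ ℂ L _ _ Algebra.toModule LieAlgebra.toModule

variable {L} in
/-- The inclusion `L → 𝔤`, `x ↦ 1 ⊗ x`. -/
def incl : L →ₗ[ℝ] Cplx L := @TensorProduct.mk ℝ _ ℂ L _ _ Algebra.toModule LieAlgebra.toModule 1

/-- The rescaling by `c` of the Killing form of `𝔤`. -/
def invForm (c : ℝ) : LinearMap.BilinForm ℂ (Cplx L) :=
  (c : ℂ) • killingForm ℂ (Cplx L)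

variable {L} in
/-- `α` is a system of simple roots of `𝔤` with respect to the Cartan subalgebra `H`: the `α i` are
linearly independent roots, and every root is a combination of them with coefficients in `ℕ`,
up to a global sign. -/
def IsSimpleSystem [FiniteDimensional ℝ L] (H : LieSubalgebra ℂ (Cplx L)) [H.IsCartanSubalgebra] {r : ℕ}
    (α : Fin r → LieModule.Weight ℂ H (Cplx L)) : Prop :=
  (∀ i, (α i).IsNonZero) ∧
  LinearIndependent ℂ (fun i => (α i : H → ℂ)) ∧
  ∀ β : LieModule.Weight ℂ H (Cplx L), β.IsNonZero → ∃ m : Fin r → ℕ,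
    (β : H → ℂ) = ∑ i, m i • (α i : H → ℂ) ∨ (β : H → ℂ) = -∑ i, m i • (α i : H → ℂ)

/-- The rescaling `(·,·) = c • Killing` of the Killing form is the normalized one: for a Cartan
subalgebra `H` with simple roots `α i`, coroots `h i` and Cartan matrix `a i j = α j (h i)`, there
are coprime positive integers `d i` such that the form induced by `(·,·)` on the dual of `H`
satisfies `(α i, α j) = d i * a i j` (so that `d i * a i j` is symmetric). The vectors `τ i` of `H`
represent the functionals `α i` through the form, so `(α i, α j) = (τ i, τ j)`. -/
def IsNormalizingScale [FiniteDimensional ℝ L] (c : ℝ) : Prop :=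
  ∃ (H : LieSubalgebra ℂ (Cplx L)) (_ : H.IsCartanSubalgebra) (r : ℕ)
    (α : Fin r → LieModule.Weight ℂ H (Cplx L)) (h τ : Fin r → H) (d : Fin r → ℕ),
    IsSimpleSystem H α ∧
    (∀ i, h i ∈ LieAlgebra.corootSpace (R := ℂ) (L := Cplx L) (H := H) (α i) ∧
      α i (h i) = 2) ∧
    (∀ i, 0 < d i) ∧ Finset.univ.gcd d = 1 ∧
    (∀ i, ∀ y : H, invForm L c (τ i) y = α i y) ∧
    ∀ i j, invForm L c (τ i) (τ j) = (d i : ℂ) * α j (h i)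

/-- The quadratic form `x ↦ (x, x)` on `𝔤`. -/
def quadForm (c : ℝ) : QuadraticForm ℂ (Cplx L) :=
  LinearMap.BilinMap.toQuadraticMap (invForm L c)

/-- The complex Clifford algebra of `𝔤`: generated by `γ x`, `x ∈ 𝔤`, with `γ x ^ 2 = (x, x)`. -/
abbrev Cl (c : ℝ) : Type _ := CliffordAlgebra (quadForm L c)

/-- The canonical map `γ`, restricted to the real Lie algebra `L`. -/
def gam (c : ℝ) : L →ₗ[ℝ] Cl L c :=
  (CliffordAlgebra.ι (quadForm L c)).restrictScalars ℝ ∘ₗ incl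

variable {L}

/-- The map `ad~ : L → Cl 𝔤`, `x ↦ (1/4) ∑ k, γ (x k) γ [x, x k]`. -/
def adTilde (c : ℝ) {κ : Type*} [Fintype κ] (x : κ → L) : L →ₗ[ℝ] Cl L c :=
  (1 / 4 : ℂ) • ∑ k, LinearMap.mulLeft ℝ (gam L c (x k)) ∘ₗ
    (gam L c ∘ₗ (LieAlgebra.ad ℝ L : L →ₗ[ℝ] Module.End ℝ L).flip (x k))

/-- A `*`-representation of the Clifford algebra on a Hilbert space. The involution of `Cl 𝔤` is
the conjugate linear one for which `γ` is `*`-preserving; since `x* = -x` for `x ∈ L`, this says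
that the elements `γ x`, `x ∈ L`, which generate `Cl 𝔤`, act by skew-adjoint operators. The C*-norm of `B(V) ⊗ B(V') ⊗ Cl 𝔤` is the operator norm on
`V ⊗ V' ⊗ S` for any faithful one. -/
structure CliffordStarRep (L : Type*) [LieRing L] [LieAlgebra ℝ L] (c : ℝ)
    (S : Type*) [NormedAddCommGroup S] [InnerProductSpace ℂ S] where
  toAlgHom : Cl L c →ₐ[ℂ] (S →L[ℂ] S)
  skew : ∀ (x : L) (v w : S),
    inner ℂ (toAlgHom (gam L c x) v) w = -inner ℂ v (toAlgHom (gam L c x) w)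

variable {S : Type*} [NormedAddCommGroup S] [InnerProductSpace ℂ S]

/-- The map `s ∘ γ : L → B(S)`. -/
def CliffordStarRep.gamma {c : ℝ} (s : CliffordStarRep L c S) : L →ₗ[ℝ] (S →L[ℂ] S) :=
  s.toAlgHom.toLinearMap.restrictScalars ℝ ∘ₗ gam L c

/-- The map `s ∘ ad~ : L → B(S)`. -/
def CliffordStarRep.spin {c : ℝ} (s : CliffordStarRep L c S) {κ : Type*} [Fintype κ]
    (x : κ → L) : L →ₗ[ℝ] (S →L[ℂ] S) :=
  s.toAlgHom.toLinearMap.restrictScalars ℝ ∘ₗ adTilde c x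

end LieAlgebra

/-! ### Unitary representations of `G` and their differentials -/

section Rep

/-- A unitary representation of the topological group `G` on a (finite dimensional) Hilbert
space: a homomorphism to the unitary group, continuous in norm. -/
structure UnitaryRep (G : Type*) [Group G] [TopologicalSpace G]
    (V : Type*) [NormedAddCommGroup V] [InnerProductSpace ℂ V] where
  toHom : G →* (V ≃ₗᵢ[ℂ] V)
  continuous_toHom : Continuous fun g => ((toHom g : V ≃L[ℂ] V) : V →L[ℂ] V)

/-- A smooth Lie group is regular enough for Mathlib's bracket on its Lie algebra. -/
instance lieGroupMinSmoothness {n : ℕ} {G : Type*} [Group G] [TopologicalSpace G]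
    [ChartedSpace (EuclideanSpace ℝ (Fin n)) G] [LieGroup (𝓡 n) ∞ G] :
    LieGroup (𝓡 n) (minSmoothness ℝ 3) G :=
  LieGroup.of_le (n := ∞) (by
    rw [minSmoothness_of_isRCLikeNormedField]
    exact WithTop.coe_le_coe.2 le_top)

instance finiteDimensionalGroupLieAlgebra {n : ℕ} {G : Type*} [Group G] [TopologicalSpace G]
    [ChartedSpace (EuclideanSpace ℝ (Fin n)) G] [LieGroup (𝓡 n) ∞ G] :
    FiniteDimensional ℝ (GroupLieAlgebra (𝓡 n) G) :=
  inferInstanceAs (FiniteDimensional ℝ (EuclideanSpace ℝ (Fin n)))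

variable {n : ℕ} {G : Type*} [Group G] [TopologicalSpace G]
  [ChartedSpace (EuclideanSpace ℝ (Fin n)) G]
  {V : Type*} [NormedAddCommGroup V] [InnerProductSpace ℂ V]

/-- The differential at the identity of a unitary representation of a Lie group. -/
def UnitaryRep.differential (π : UnitaryRep G V) :
    GroupLieAlgebra (𝓡 n) G →ₗ[ℝ] (V →L[ℂ] V) :=
  (mfderiv (𝓡 n) 𝓘(ℝ, V →L[ℂ] V)
    (fun g : G => ((π.toHom g : V ≃L[ℂ] V) : V →L[ℂ] V)) 1).toLinearMap

end Rep

/-! ### The element `t` and the Drinfeld associator -/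

section Associator

/-- The algebra of operators on the (finite dimensional) Hilbert space `W`. -/
abbrev Op (W : Type*) [NormedAddCommGroup W] [InnerProductSpace ℂ W] : Type _ := W →L[ℂ] W

variable {W : Type*} [NormedAddCommGroup W] [InnerProductSpace ℂ W]

/-- `z ^ T = exp (log z • T)` for a real number `z > 0`. -/
def opPow (z : ℝ) (T : Op W) : Op W :=
  NormedSpace.exp ((Real.log z : ℂ) • T)

/-- `ħ = log q / (π i)`. -/
def hbar (q : ℝ) : ℂ := (Real.log q : ℂ) / ((Real.pi : ℂ) * Complex.I)

/-- `F` solves `F' = ħ (A / x + B / (x - 1)) F` on `(0, 1)`. -/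
def SolvesKZ (ħ : ℂ) (A B : Op W) (F : ℝ → Op W) : Prop :=
  ∀ x ∈ Set.Ioo (0 : ℝ) 1,
    HasDerivAt F ((ħ • (((x : ℂ)⁻¹) • A + ((x : ℂ) - 1)⁻¹ • B)) * F x) x

/-- The function `F` on `(0, 1)` extends to a holomorphic function in the unit disc with
value `1` at `0`. -/
def ExtendsToDisc (F : ℝ → Op W) : Prop :=
  ∃ Fh : ℂ → Op W, DifferentiableOn ℂ Fh (Metric.ball 0 1) ∧ Fh 0 = 1 ∧
    ∀ x ∈ Set.Ioo (0 : ℝ) 1, Fh x = F x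

/-- `Φ` is the connection matrix of the KZ equation: `G₀ = G₁ Φ` for the solutions `G₀` and `G₁`
such that `G₀(x) x^{-ħA}` and `G₁(1-x) x^{-ħB}` extend to holomorphic functions in the unit disc
with value `1` at `0`. -/
def IsKZAssociator (ħ : ℂ) (A B Φ : Op W) : Prop :=
  ∃ G₀ G₁ : ℝ → Op W,
    SolvesKZ ħ A B G₀ ∧ SolvesKZ ħ A B G₁ ∧
    ExtendsToDisc (fun x => G₀ x * opPow x (-(ħ • A))) ∧
    ExtendsToDisc (fun x => G₁ (1 - x) * opPow x (-(ħ • B))) ∧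
    ∀ x ∈ Set.Ioo (0 : ℝ) 1, G₀ x = G₁ x * Φ

variable {L : Type*} [AddCommGroup L] [Module ℝ L] {κ : Type*} [Fintype κ]
  {V₁ V₂ V₃ : Type*}
  [NormedAddCommGroup V₁] [InnerProductSpace ℂ V₁]
  [NormedAddCommGroup V₂] [InnerProductSpace ℂ V₂]
  [NormedAddCommGroup V₃] [InnerProductSpace ℂ V₃]

/-- `(ρ₁ ⊗ ρ₂)(t)` for `t = -∑ k, x k ⊗ x k`. -/
def tElt (x : κ → L) (ρ₁ : L →ₗ[ℝ] (V₁ →L[ℂ] V₁)) (ρ₂ : L →ₗ[ℝ] (V₂ →L[ℂ] V₂)) :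
    Op (V₁ ⊗[ℂ] V₂) :=
  -∑ k, TensorProduct.mapL (ρ₁ (x k)) (ρ₂ (x k))

/-- `(ρ₁ ⊗ ρ₂ ⊗ ι)(t₁₂)`. -/
def t12 (V₃ : Type*) [NormedAddCommGroup V₃] [InnerProductSpace ℂ V₃]
    (x : κ → L) (ρ₁ : L →ₗ[ℝ] (V₁ →L[ℂ] V₁)) (ρ₂ : L →ₗ[ℝ] (V₂ →L[ℂ] V₂)) :
    Op (V₁ ⊗[ℂ] (V₂ ⊗[ℂ] V₃)) :=
  -∑ k, TensorProduct.mapL (ρ₁ (x k))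
    (TensorProduct.mapL (ρ₂ (x k)) (ContinuousLinearMap.id ℂ V₃))

/-- `(ι ⊗ ρ₂ ⊗ ρ₃)(t₂₃)`. -/
def t23 (V₁ : Type*) [NormedAddCommGroup V₁] [InnerProductSpace ℂ V₁]
    (x : κ → L) (ρ₂ : L →ₗ[ℝ] (V₂ →L[ℂ] V₂)) (ρ₃ : L →ₗ[ℝ] (V₃ →L[ℂ] V₃)) :
    Op (V₁ ⊗[ℂ] (V₂ ⊗[ℂ] V₃)) :=
  TensorProduct.mapL (ContinuousLinearMap.id ℂ V₁) (tElt x ρ₂ ρ₃)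

/-- `Φ` is `(ρ₁ ⊗ ρ₂ ⊗ ρ₃)(Φ_KZ) = Φ(t₁₂, t₂₃)`, the value of the Drinfeld associator with
parameter `q` in the representations with differentials `ρ₁`, `ρ₂`, `ρ₃`. For a simply connected
group the `*`-representations of its Lie algebra, such as `s ∘ ad~`, are exactly the differentials
of its unitary representations. -/
def IsDrinfeldAssociator (q : ℝ) (x : κ → L) (ρ₁ : L →ₗ[ℝ] (V₁ →L[ℂ] V₁))
    (ρ₂ : L →ₗ[ℝ] (V₂ →L[ℂ] V₂)) (ρ₃ : L →ₗ[ℝ] (V₃ →L[ℂ] V₃))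
    (Φ : Op (V₁ ⊗[ℂ] (V₂ ⊗[ℂ] V₃))) : Prop :=
  IsKZAssociator (hbar q) (t12 V₃ x ρ₁ ρ₂) (t23 V₁ x ρ₂ ρ₃) Φ

end Associator

end KZ

end

/-!
The associator is the connection matrix of the equation `G' = ħ (A / x + B / (x - 1)) G` for
`A = t₁₂` and `B = t₂₃`, the last leg acting through the spin representation `s ∘ ad~`. Both operators
are self-adjoint, because unitary representations have skew-adjoint differentials.

*Solutions.* A solution normalized at an end point is a holomorphic function times a power of `x`;
its Taylor coefficients are given by a recursion that can be solved because `n - ħ [A, ·]` is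
invertible for `n ≥ 1` (`exists_coefficients`, `exists_holomorphic_factor`). As `ħ` is purely
imaginary and `A`, `B` are self-adjoint, the normalized solutions `G₀`, `G₁` are unitary. Hence `Φ`
exists and is unique (`existsUnique_isKZAssociator`).

*Algebra.* Put `D = (ι ⊗ π' ⊗ sγ)(t₂₃)`, a Dirac operator, and let `E` be the element `t` placed in
the legs `1` and `3`, where the third leg acts by `sγ`, so that `‖E‖ ≤ ‖(π ⊗ sγ)(t)‖`. Invariance
of the form and the Clifford relations give `[D, B] = 0`, `[E + D, A] = 0` and `[E, A + B] = 0`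
(`commute_relations`). The first of these holds because `D ^ 2` is a Casimir element minus `2 B`.

*Estimate.* Let `Z = G₁* D G₀ + (1 - x) G₁* E G₀` on `(0, 1)`. The three relations cancel all
singular terms in its derivative and leave `Z' = -G₁* E G₀`, whose norm is at most `‖E‖` by unitarity.
Because `D + E` commutes with `A` and `D` commutes with `B`, `Z` tends to `Φ (D + E)` at `0` and to
`D Φ` at `1`. Therefore `‖[D, Φ]‖ ≤ 2 ‖E‖` (`norm_commutator_associator_le`), which is stronger than
the required bound.

*Differentials.* Mathlib has no theorem that continuous homomorphisms from Lie groups are smooth.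
For a compact group, averaging a homomorphism into a Banach algebra against a bump function shows
that it is differentiable at the identity (`differentiableAt_chartHom`); the group law then makes it
twice continuously differentiable near the identity, and pairing it with left-invariant vector fields
shows that its differential respects brackets (`homDeriv_lie`).
-/

noncomputable section

/-! ### Commutation relations between the Casimir elements -/

section Casimir

variable {L : Type*} [LieRing L] [LieAlgebra ℝ L] {κ : Type*} [Fintype κ]

/-- Every `ad y` has a skew-symmetric matrix in the basis `x`: invariance of the form for which `x` is
orthonormal, in terms of coordinates. -/
def AdSkew (x : Module.Basis κ ℝ L) : Prop :=
  ∀ (y : L) (k l : κ), x.repr ⁅y, x k⁆ l = -x.repr ⁅y, x l⁆ k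

variable {x : Module.Basis κ ℝ L}
  {R : Type*} [Ring R] [Module ℝ R] [IsScalarTower ℝ R R] [SMulCommClass ℝ R R]

/-- Invariance of `∑ k, x k ⊗ x k` under the adjoint action. -/
lemma AdSkew.sum_lie_mul (hx : AdSkew x) (P Q : L →ₗ[ℝ] R) (y : L) :
    ∑ k, P ⁅y, x k⁆ * Q (x k) = -∑ k, P (x k) * Q ⁅y, x k⁆ := by
  have hP : ∀ k, P ⁅y, x k⁆ = ∑ l, x.repr ⁅y, x k⁆ l • P (x l) := fun k => by
    conv_lhs => rw [← x.sum_repr ⁅y, x k⁆]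
    simp only [map_sum, map_smul]
  have hQ : ∀ k, Q ⁅y, x k⁆ = ∑ l, x.repr ⁅y, x k⁆ l • Q (x l) := fun k => by
    conv_lhs => rw [← x.sum_repr ⁅y, x k⁆]
    simp only [map_sum, map_smul]
  simp only [hP, hQ, Finset.sum_mul, Finset.mul_sum, smul_mul_assoc, mul_smul_comm]
  rw [Finset.sum_comm, ← Finset.sum_neg_distrib]
  refine Finset.sum_congr rfl fun k _ => ?_
  rw [← Finset.sum_neg_distrib]
  refine Finset.sum_congr rfl fun l _ => ?_
  rw [hx y l k, neg_smul]

/-- The form for which the basis `x` is orthonormal, up to the sign coming from compactness. -/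
def basisForm (x : Module.Basis κ ℝ L) (y z : L) : ℝ := -∑ m, x.repr y m * x.repr z m

lemma basisForm_basis (k : κ) (z : L) : basisForm x (x k) z = -x.repr z k := by
  classical
  simp [basisForm, Finsupp.single_apply]

lemma basisForm_comm (y z : L) : basisForm x y z = basisForm x z y := by
  simp only [basisForm, mul_comm]

lemma AdSkew.basisForm_lie (hx : AdSkew x) (y z : L) (k : κ) :
    basisForm x ⁅y, x k⁆ z = x.repr ⁅y, z⁆ k := by
  conv_rhs => rw [← x.sum_repr z]
  simp only [lie_sum, lie_smul, map_sum, map_smul, Finsupp.coe_finsetSum, Finset.sum_apply,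
    Finsupp.smul_apply, smul_eq_mul, basisForm, ← Finset.sum_neg_distrib]
  refine Finset.sum_congr rfl fun m _ => ?_
  rw [hx y k m]
  ring

/-- The elements `∑ k, γ (x k) γ ⁅y, x k⁆` implement the adjoint action on the generators of the
Clifford algebra. -/
lemma AdSkew.clifford_commutator (hx : AdSkew x) {g σ : L →ₗ[ℝ] R}
    (hg : ∀ y z, g y * g z + g z * g y = (2 * basisForm x y z) • (1 : R))
    (hσ : ∀ y, (4 : ℝ) • σ y = ∑ k, g (x k) * g ⁅y, x k⁆) (y z : L) :
    σ y * g z - g z * σ y = g ⁅y, z⁆ := by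
  have h1 : ∀ k, g (x k) * g ⁅y, x k⁆ * g z - g z * (g (x k) * g ⁅y, x k⁆) =
      (2 : ℝ) • (x.repr ⁅y, z⁆ k • g (x k)) + (2 : ℝ) • (x.repr z k • g ⁅y, x k⁆) := fun k => by
    have e1 := hg ⁅y, x k⁆ z
    have e2 := hg (x k) z
    rw [hx.basisForm_lie] at e1
    rw [basisForm_basis] at e2
    rw [smul_smul, smul_smul]
    have e3 : g (x k) * (g ⁅y, x k⁆ * g z + g z * g ⁅y, x k⁆) =
        (2 * x.repr ⁅y, z⁆ k) • g (x k) := by rw [e1, mul_smul_comm, mul_one]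
    have e4 : (g (x k) * g z + g z * g (x k)) * g ⁅y, x k⁆ =
        (2 * -x.repr z k) • g ⁅y, x k⁆ := by rw [e2, smul_mul_assoc, one_mul]
    rw [← e3, ← neg_neg ((2 * x.repr z k) • g ⁅y, x k⁆), ← neg_smul, ← mul_neg, ← e4]
    noncomm_ring
  have h2 : (4 : ℝ) • (σ y * g z - g z * σ y) = (4 : ℝ) • g ⁅y, z⁆ := by
    rw [smul_sub, ← smul_mul_assoc, ← mul_smul_comm, hσ, Finset.sum_mul, Finset.mul_sum,
      ← Finset.sum_sub_distrib, Finset.sum_congr rfl fun k _ => h1 k, Finset.sum_add_distrib,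
      ← Finset.smul_sum, ← Finset.smul_sum]
    have s1 : ∑ k, x.repr ⁅y, z⁆ k • g (x k) = g ⁅y, z⁆ := by
      conv_rhs => rw [← x.sum_repr ⁅y, z⁆]
      simp only [map_sum, map_smul]
    have s2 : ∑ k, x.repr z k • g ⁅y, x k⁆ = g ⁅y, z⁆ := by
      conv_rhs => rw [← x.sum_repr z]
      simp only [map_sum, map_smul, lie_sum, lie_smul]
    rw [s1, s2, ← add_smul]
    norm_num
  simpa [smul_smul] using congrArg (fun r => (4 : ℝ)⁻¹ • r) h2

variable {P Q g σ : L →ₗ[ℝ] R}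

/-- `t₁₃ + t₂₃` is invariant for the diagonal action on the first two legs, hence commutes
with `t₁₂`. -/
lemma AdSkew.commute_add (hx : AdSkew x)
    (hP : ∀ y z, P ⁅y, z⁆ = P y * P z - P z * P y)
    (hQ : ∀ y z, Q ⁅y, z⁆ = Q y * Q z - Q z * Q y)
    (hPQ : ∀ y z, Commute (P y) (Q z)) (hPg : ∀ y z, Commute (P y) (g z))
    (hQg : ∀ y z, Commute (Q y) (g z)) :
    Commute (∑ k, P (x k) * g (x k) + ∑ k, Q (x k) * g (x k)) (∑ l, P (x l) * Q (x l)) := by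
  have key : ∀ k, Commute (P (x k) + Q (x k)) (∑ l, P (x l) * Q (x l)) := fun k => by
    have h := hx.sum_lie_mul P Q (x k)
    rw [Commute, SemiconjBy, ← sub_eq_zero, Finset.mul_sum, Finset.sum_mul,
      ← Finset.sum_sub_distrib, ← sub_eq_zero.mpr h, sub_neg_eq_add, ← Finset.sum_add_distrib]
    refine Finset.sum_congr rfl fun l _ => ?_
    have e : Q (x k) * (P (x l) * Q (x l)) = P (x l) * (Q (x k) * Q (x l)) := by
      rw [← mul_assoc, ← (hPQ _ _).eq, mul_assoc]
    have e' : P (x l) * Q (x l) * P (x k) = P (x l) * P (x k) * Q (x l) := by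
      rw [mul_assoc, ← (hPQ _ _).eq, mul_assoc]
    rw [hP, hQ, add_mul, mul_add, e, e']
    noncomm_ring
  rw [← Finset.sum_add_distrib]
  refine Commute.sum_left _ _ _ fun k _ => ?_
  rw [← add_mul]
  refine (key k).mul_left (Commute.sum_right _ _ _ fun l _ => ?_)
  exact ((hPg _ _).symm.mul_right (hQg _ _).symm)

/-- If `σ` implements the adjoint action on `g`, then `∑ k, P (x k) g (x k)` is invariant for the
diagonal action of `P` and `σ`. -/
lemma AdSkew.commute_diagonal (hx : AdSkew x)
    (hP : ∀ y z, P ⁅y, z⁆ = P y * P z - P z * P y)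
    (hσg : ∀ y z, σ y * g z - g z * σ y = g ⁅y, z⁆)
    (hPg : ∀ y z, Commute (P y) (g z)) (hPσ : ∀ y z, Commute (P y) (σ z)) (y : L) :
    Commute (P y + σ y) (∑ k, P (x k) * g (x k)) := by
  have h := hx.sum_lie_mul P g y
  rw [Commute, SemiconjBy, ← sub_eq_zero, Finset.mul_sum, Finset.sum_mul,
    ← Finset.sum_sub_distrib, ← sub_eq_zero.mpr h, sub_neg_eq_add, ← Finset.sum_add_distrib]
  refine Finset.sum_congr rfl fun l _ => ?_
  have e : σ y * (P (x l) * g (x l)) = P (x l) * (σ y * g (x l)) := by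
    rw [← mul_assoc, ← (hPσ _ _).eq, mul_assoc]
  have e' : P (x l) * g (x l) * P y = P (x l) * P y * g (x l) := by
    rw [mul_assoc, ← (hPg _ _).eq, mul_assoc]
  rw [hP, ← hσg, add_mul, mul_add, e, e']
  noncomm_ring

/-- `t₁₃` in the representation `P ⊗ g` commutes with `t₁₂ + t₂₃`. -/
lemma AdSkew.commute_outer (hx : AdSkew x)
    (hP : ∀ y z, P ⁅y, z⁆ = P y * P z - P z * P y)
    (hσg : ∀ y z, σ y * g z - g z * σ y = g ⁅y, z⁆)
    (hPQ : ∀ y z, Commute (P y) (Q z)) (hPg : ∀ y z, Commute (P y) (g z))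
    (hQg : ∀ y z, Commute (Q y) (g z)) (hPσ : ∀ y z, Commute (P y) (σ z)) :
    Commute (∑ k, P (x k) * g (x k)) (∑ l, P (x l) * Q (x l) + ∑ l, Q (x l) * σ (x l)) := by
  rw [← Finset.sum_add_distrib]
  refine Commute.sum_right _ _ _ fun l _ => ?_
  rw [(hPQ _ _).eq, ← mul_add]
  refine Commute.mul_right (Commute.sum_left _ _ _ fun k _ => ?_)
    (hx.commute_diagonal hP hσg hPg hPσ _).symm
  exact (hPQ _ _).mul_left (hQg _ _).symm

/-- The square of the Dirac operator `∑ k, Q (x k) g (x k)` is a Casimir element plus a multiple of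
`t₂₃`; as the Casimir element is central, the Dirac operator commutes with `t₂₃`. -/
lemma AdSkew.commute_dirac (hx : AdSkew x)
    (hQ : ∀ y z, Q ⁅y, z⁆ = Q y * Q z - Q z * Q y)
    (hg : ∀ y z, g y * g z + g z * g y = (2 * basisForm x y z) • (1 : R))
    (hσ : ∀ y, (4 : ℝ) • σ y = ∑ k, g (x k) * g ⁅y, x k⁆)
    (hQg : ∀ y z, Commute (Q y) (g z)) :
    Commute (∑ k, Q (x k) * g (x k)) (∑ l, Q (x l) * σ (x l)) := by
  classical
  set D := ∑ k, Q (x k) * g (x k) with hD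
  set C := ∑ k, Q (x k) * Q (x k) with hC
  have hCQ : ∀ y, Commute (Q y) C := fun y => by
    have h := hx.sum_lie_mul Q Q y
    rw [Commute, SemiconjBy, ← sub_eq_zero, Finset.mul_sum, Finset.sum_mul,
      ← Finset.sum_sub_distrib, ← sub_eq_zero.mpr h, sub_neg_eq_add, ← Finset.sum_add_distrib]
    refine Finset.sum_congr rfl fun l _ => ?_
    rw [hQ]
    noncomm_ring
  have hCD : Commute D C := Commute.sum_left _ _ _ fun k _ =>
    (hCQ _).mul_left (Commute.sum_right _ _ _ fun l _ =>
      (hQg _ _).symm.mul_right (hQg _ _).symm)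
  have hprod : ∀ k l, Q (x k) * g (x k) * (Q (x l) * g (x l)) =
      Q (x k) * Q (x l) * (g (x k) * g (x l)) := fun k l => by
    rw [mul_assoc, ← mul_assoc (g _), ← (hQg _ _).eq]
    noncomm_ring
  have hDD : D * D = ∑ k, ∑ l, Q (x k) * Q (x l) * (g (x k) * g (x l)) := by
    rw [hD, Finset.sum_mul_sum]
    exact Finset.sum_congr rfl fun k _ => Finset.sum_congr rfl fun l _ => hprod k l
  have hDD' : D * D = ∑ k, ∑ l, Q (x l) * Q (x k) * (g (x l) * g (x k)) := by
    rw [hDD, Finset.sum_comm]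
  have hterm : ∀ k l, Q (x k) * Q (x l) * (g (x k) * g (x l)) +
      Q (x l) * Q (x k) * (g (x l) * g (x k)) =
      Q ⁅x k, x l⁆ * (g (x k) * g (x l)) +
        (if k = l then (-2 : ℝ) else 0) • (Q (x l) * Q (x k)) := fun k l => by
    have e := hg (x k) (x l)
    rw [basisForm_basis] at e
    have e' : g (x l) * g (x k) = (if k = l then (-2 : ℝ) else 0) • 1 - g (x k) * g (x l) := by
      rw [eq_sub_iff_add_eq', e]
      congr 1
      split_ifs <;> simp_all [eq_comm]
    rw [e', hQ, mul_sub, mul_smul_comm, mul_one, sub_mul]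
    abel
  have hsum : ∀ k, ∑ l, Q ⁅x k, x l⁆ * (g (x k) * g (x l)) =
      ∑ l, Q (x l) * (g (x k) * g ⁅x l, x k⁆) := fun k => by
    have h := hx.sum_lie_mul Q g (x k)
    have c : ∀ a b, Q a * (g (x k) * g b) = g (x k) * (Q a * g b) := fun a b => by
      rw [← mul_assoc, (hQg _ _).eq, mul_assoc]
    simp only [c, ← Finset.mul_sum, h]
    rw [← Finset.sum_neg_distrib]
    congr 1
    refine Finset.sum_congr rfl fun l _ => ?_
    rw [← lie_skew, map_neg, mul_neg, neg_neg]
  have hmain : (2 : ℝ) • (D * D) = (4 : ℝ) • (∑ l, Q (x l) * σ (x l)) + (-2 : ℝ) • C := by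
    rw [two_smul]
    conv_lhs => enter [2]; rw [hDD']
    rw [hDD, ← Finset.sum_add_distrib]
    simp only [← Finset.sum_add_distrib, hterm]
    simp only [Finset.sum_add_distrib, hsum]
    congr 1
    · rw [Finset.sum_comm, Finset.smul_sum]
      refine Finset.sum_congr rfl fun l _ => ?_
      rw [← mul_smul_comm, hσ, Finset.mul_sum]
    · simp [hC, Finset.smul_sum, ite_smul]
  have hB : (∑ l, Q (x l) * σ (x l)) = (4 : ℝ)⁻¹ • ((2 : ℝ) • (D * D) + (2 : ℝ) • C) := by
    rw [hmain, add_assoc, ← add_smul, smul_add, smul_smul]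
    norm_num
  rw [hB]
  refine Commute.smul_right (Commute.add_right ?_ (hCD.smul_right _)) _
  exact ((Commute.refl D).mul_right (Commute.refl D)).smul_right _

end Casimir

/-! ### Power series solutions at a regular singular point -/

section PowerSeries

open Filter Topology

lemma CStarRing.norm_one_le' (𝔸 : Type*) [CStarAlgebra 𝔸] : ‖(1 : 𝔸)‖ ≤ 1 := by
  rcases subsingleton_or_nontrivial 𝔸 with h | h
  · rw [Subsingleton.elim (1 : 𝔸) 0, norm_zero]
    exact zero_le_one
  · exact CStarRing.norm_one.le

variable {𝔸 : Type*} [CStarAlgebra 𝔸]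

/-- For skew-adjoint `K` the derivation `[K, ·]` generates a flow of isometries, so that
`n - [K, ·]` is bounded below by `n`. Instead of the flow, the proof uses its first order
approximation `X ↦ (1 + h K) X (1 - h K)`, whose norm is `1 + O(h ^ 2)`. -/
lemma mul_norm_le_norm_sub_commutator {K : 𝔸} (hK : star K = -K) (n : ℝ) (X : 𝔸) :
    n * ‖X‖ ≤ ‖(n : ℂ) • X - (K * X - X * K)‖ := by
  set Y := (n : ℂ) • X - (K * X - X * K) with hY
  have hstar : ∀ h : ℝ, ‖1 + (h : ℂ) • K‖ * ‖1 - (h : ℂ) • K‖ ≤ 1 + h ^ 2 * ‖K‖ ^ 2 := fun h => by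
    have e : star (1 + (h : ℂ) • K) = 1 - (h : ℂ) • K := by
      simp [hK, sub_eq_add_neg]
    have e2 : star (1 + (h : ℂ) • K) * (1 + (h : ℂ) • K) = 1 - ((h ^ 2 : ℝ) : ℂ) • (K * K) := by
      rw [e, sub_mul, one_mul, mul_add, mul_one, smul_mul_smul_comm]
      push_cast
      rw [sq]
      abel
    rw [← e, norm_star, ← CStarRing.norm_star_mul_self, e2]
    refine (norm_sub_le _ _).trans (add_le_add (CStarRing.norm_one_le' 𝔸) ?_)
    rw [norm_smul, Complex.norm_real, Real.norm_of_nonneg (sq_nonneg h), sq ‖K‖]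
    exact mul_le_mul_of_nonneg_left (norm_mul_le _ _) (sq_nonneg h)
  have key : ∀ h : ℝ, 0 < h → n * ‖X‖ ≤ ‖Y‖ + h * (2 * ‖K‖ ^ 2 * ‖X‖) := fun h hh => by
    have e : ((1 + h * n : ℝ) : ℂ) • X = (h : ℂ) • Y + (1 + (h : ℂ) • K) * X * (1 - (h : ℂ) • K) +
        ((h ^ 2 : ℝ) : ℂ) • (K * X * K) := by
      rw [hY]
      push_cast
      simp only [smul_sub, add_mul, mul_sub, one_mul, mul_one, smul_mul_assoc, mul_smul_comm,
        smul_smul, add_smul, one_smul, sq, smul_add]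
      abel
    have h1 : (1 + h * n) * ‖X‖ ≤ ‖((1 + h * n : ℝ) : ℂ) • X‖ := by
      rw [norm_smul, Complex.norm_real]
      exact mul_le_mul_of_nonneg_right (Real.le_norm_self _) (norm_nonneg _)
    have h2 : ‖(1 + (h : ℂ) • K) * X * (1 - (h : ℂ) • K)‖ ≤ (1 + h ^ 2 * ‖K‖ ^ 2) * ‖X‖ :=
      calc _ ≤ ‖1 + (h : ℂ) • K‖ * ‖X‖ * ‖1 - (h : ℂ) • K‖ :=
            (norm_mul_le _ _).trans (mul_le_mul_of_nonneg_right (norm_mul_le _ _) (norm_nonneg _))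
        _ = ‖1 + (h : ℂ) • K‖ * ‖1 - (h : ℂ) • K‖ * ‖X‖ := by ring
        _ ≤ _ := mul_le_mul_of_nonneg_right (hstar h) (norm_nonneg _)
    have h3 : ‖((h ^ 2 : ℝ) : ℂ) • (K * X * K)‖ ≤ h ^ 2 * (‖K‖ * ‖X‖ * ‖K‖) := by
      rw [norm_smul, Complex.norm_real, Real.norm_of_nonneg (sq_nonneg h)]
      exact mul_le_mul_of_nonneg_left ((norm_mul_le _ _).trans
        (mul_le_mul_of_nonneg_right (norm_mul_le _ _) (norm_nonneg _))) (sq_nonneg h)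
    have h4 : ‖(h : ℂ) • Y‖ = h * ‖Y‖ := by
      rw [norm_smul, Complex.norm_real, Real.norm_of_nonneg hh.le]
    have h5 : h * (n * ‖X‖) ≤ h * (‖Y‖ + h * (2 * ‖K‖ ^ 2 * ‖X‖)) := by
      rw [e] at h1
      have := h1.trans ((norm_add_le _ _).trans (add_le_add (norm_add_le _ _) le_rfl))
      rw [h4] at this
      linarith
    exact le_of_mul_le_mul_left h5 hh
  have hlim : Tendsto (fun h : ℝ => ‖Y‖ + h * (2 * ‖K‖ ^ 2 * ‖X‖)) (𝓝[>] 0) (𝓝 ‖Y‖) := by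
    have : Continuous fun h : ℝ => ‖Y‖ + h * (2 * ‖K‖ ^ 2 * ‖X‖) := by fun_prop
    simpa using (this.tendsto 0).mono_left nhdsWithin_le_nhds
  exact ge_of_tendsto hlim (eventually_mem_nhdsWithin.mono fun h hh => key h hh)

/-- The operator `n - [K, ·]`. -/
def resonanceMap (K : 𝔸) (n : ℝ) : 𝔸 →ₗ[ℂ] 𝔸 :=
  (n : ℂ) • LinearMap.id - (LinearMap.mulLeft ℂ K - LinearMap.mulRight ℂ K)

lemma resonanceMap_apply (K : 𝔸) (n : ℝ) (X : 𝔸) :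
    resonanceMap K n X = (n : ℂ) • X - (K * X - X * K) := rfl

/-- There are no resonances: `n - [K, ·]` is invertible for `n > 0`, with inverse of norm at most
`1 / n`. -/
lemma exists_resonanceMap_eq [FiniteDimensional ℂ 𝔸] {K : 𝔸} (hK : star K = -K) {n : ℝ}
    (hn : 0 < n) (Y : 𝔸) : ∃ X, resonanceMap K n X = Y ∧ n * ‖X‖ ≤ ‖Y‖ := by
  have hinj : Function.Injective (resonanceMap K n) := by
    refine (injective_iff_map_eq_zero _).mpr fun X hX => ?_
    have h := mul_norm_le_norm_sub_commutator hK n X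
    rw [← resonanceMap_apply, hX, norm_zero] at h
    exact norm_le_zero_iff.mp (nonpos_of_mul_nonpos_right h hn)
  obtain ⟨X, hX⟩ := LinearMap.surjective_of_injective hinj Y
  refine ⟨X, hX, ?_⟩
  have h := mul_norm_le_norm_sub_commutator hK n X
  rwa [← resonanceMap_apply, hX] at h

/-- The coefficients `c` of the power series solution and their partial sums `S`, which enter the
recursion through `(z - 1)⁻¹ = -∑ n, z ^ n`. For an integer `m ≥ ‖M‖` the recursion gives
`(n + 1) ‖c (n + 1)‖ ≤ m ‖S n‖`, and the binomial coefficients `(n + m).choose m` satisfy the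
corresponding equality, so they bound `S`. -/
lemma exists_coefficients [FiniteDimensional ℂ 𝔸] {K : 𝔸} (hK : star K = -K) (M : 𝔸) :
    ∃ (c S : ℕ → 𝔸) (m : ℕ), c 0 = 1 ∧ S 0 = 1 ∧ (∀ n, S (n + 1) = S n + c (n + 1)) ∧
      (∀ n : ℕ, ((n + 1 : ℕ) : ℂ) • c (n + 1) = K * c (n + 1) - c (n + 1) * K - M * S n) ∧
      (∀ n, ‖S n‖ ≤ (n + m).choose m) ∧
      ∀ n : ℕ, (n + 1) * ‖c (n + 1)‖ ≤ m * (n + m).choose m := by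
  have hex : ∀ (n : ℕ) (Y : 𝔸), ∃ X, resonanceMap K (n + 1 : ℕ) X = Y ∧
      ((n + 1 : ℕ) : ℝ) * ‖X‖ ≤ ‖Y‖ := fun n Y => exists_resonanceMap_eq hK (by positivity) Y
  choose T hT hTn using hex
  let S : ℕ → 𝔸 := fun n => Nat.rec 1 (fun n s => s + T n (-(M * s))) n
  let c : ℕ → 𝔸 := fun n => Nat.casesOn n 1 fun n => T n (-(M * S n))
  have hS : ∀ n, S (n + 1) = S n + c (n + 1) := fun n => rfl
  have hc : ∀ n, c (n + 1) = T n (-(M * S n)) := fun n => rfl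
  obtain ⟨m, hm⟩ := exists_nat_ge ‖M‖
  have hcn : ∀ n : ℕ, (n + 1) * ‖c (n + 1)‖ ≤ m * ‖S n‖ := fun n => by
    have h := hTn n (-(M * S n))
    rw [norm_neg, ← hc] at h
    push_cast at h
    exact h.trans ((norm_mul_le _ _).trans (mul_le_mul_of_nonneg_right hm (norm_nonneg _)))
  have hSn : ∀ n, ‖S n‖ ≤ (n + m).choose m := fun n => by
    induction n with
    | zero =>
      change ‖(1 : 𝔸)‖ ≤ _
      simpa using CStarRing.norm_one_le' 𝔸
    | succ n ih =>
      have h1 : (n + 1 : ℝ) * ‖S (n + 1)‖ ≤ (n + 1) * (n + 1 + m).choose m := by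
        have h2 : (n + 1 : ℝ) * ‖S (n + 1)‖ ≤ (n + 1 + m) * ‖S n‖ := by
          have := mul_le_mul_of_nonneg_left (norm_add_le (S n) (c (n + 1)))
            (by positivity : (0 : ℝ) ≤ n + 1)
          rw [← hS] at this
          linarith [hcn n]
        have h3 : ((n + 1 : ℕ) : ℝ) * (n + 1 + m).choose m = (n + 1 + m) * (n + m).choose m := by
          have := Nat.add_one_mul_choose_eq (n + m) n
          rw [Nat.choose_symm_add, show n + m + 1 = n + 1 + m by ring, Nat.choose_symm_add] at this
          rw [mul_comm]
          exact_mod_cast this.symm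
        push_cast at h3
        rw [h3]
        exact h2.trans (mul_le_mul_of_nonneg_left ih (by positivity))
      exact le_of_mul_le_mul_left h1 (by positivity)
  refine ⟨c, S, m, rfl, rfl, hS, fun n => ?_, hSn, fun n =>
    (hcn n).trans (mul_le_mul_of_nonneg_left (hSn n) (by positivity))⟩
  have h := hT n (-(M * S n))
  rw [← hc, resonanceMap_apply, sub_eq_iff_eq_add] at h
  push_cast at h ⊢
  rw [h]
  abel

/-- The sum of a power series with polynomially growing coefficients is differentiable in the unit
disc, with the expected derivative. -/
lemma hasDerivAt_tsum_pow_smul {c : ℕ → 𝔸} {m : ℕ} {C : ℝ}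
    (hc : ∀ n : ℕ, (n + 1) * ‖c (n + 1)‖ ≤ C * (n + m).choose m) {z : ℂ} (hz : ‖z‖ < 1) :
    Summable (fun n => z ^ n • c n) ∧
    Summable (fun n : ℕ => z ^ n • (((n + 1 : ℕ) : ℂ) • c (n + 1))) ∧
    HasDerivAt (fun z : ℂ => ∑' n, z ^ n • c n)
      (∑' n : ℕ, z ^ n • (((n + 1 : ℕ) : ℂ) • c (n + 1))) z := by
  obtain ⟨r, hzr, hr⟩ := exists_between hz
  have hr0 : 0 ≤ r := (norm_nonneg z).trans hzr.le
  have hC : 0 ≤ C := by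
    have h := hc 0
    simp only [Nat.cast_zero, zero_add, one_mul, Nat.choose_self, Nat.cast_one, mul_one] at h
    exact (norm_nonneg _).trans h
  have hsum : Summable fun n : ℕ => C * (((n + m).choose m : ℝ) * r ^ n) :=
    (summable_choose_mul_geometric_of_norm_lt_one m
      (by rwa [Real.norm_of_nonneg hr0])).mul_left C
  have hbound : ∀ (n : ℕ) (y : ℂ), ‖y‖ < r → ‖y ^ n • (((n + 1 : ℕ) : ℂ) • c (n + 1))‖ ≤
      C * (((n + m).choose m : ℝ) * r ^ n) := fun n y hy => by
    rw [norm_smul, norm_smul, norm_pow, Complex.norm_natCast, ← mul_assoc C, mul_comm]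
    refine mul_le_mul ?_ (pow_le_pow_left₀ (norm_nonneg _) hy.le n) (by positivity) (by positivity)
    exact_mod_cast hc n
  have hs' : Summable (fun n : ℕ => z ^ n • (((n + 1 : ℕ) : ℂ) • c (n + 1))) :=
    Summable.of_norm_bounded hsum fun n => hbound n z hzr
  refine ⟨?_, hs', ?_⟩
  · refine (summable_nat_add_iff 1).mp (Summable.of_norm_bounded hsum fun n => ?_)
    refine le_trans ?_ (hbound n z hzr)
    simp only [norm_smul, norm_mul, norm_pow, Complex.norm_natCast, pow_succ]
    rw [mul_assoc]
    refine mul_le_mul_of_nonneg_left ?_ (by positivity)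
    refine mul_le_mul_of_nonneg_right (hz.le.trans ?_) (norm_nonneg _)
    push_cast
    linarith [n.cast_nonneg (α := ℝ)]
  · set u : ℕ → ℝ := fun n => Nat.casesOn n 0 fun n => C * (((n + m).choose m : ℝ) * r ^ n) with hu
    have hus : Summable u := (summable_nat_add_iff 1).mp hsum
    have h := hasDerivAt_tsum_of_isPreconnected (g := fun n (y : ℂ) => y ^ n • c n)
      (g' := fun n y => ((n : ℂ) * y ^ (n - 1)) • c n) (y₀ := 0) (y := z) hus
      (Metric.isOpen_ball (x := (0 : ℂ)) (ε := r)) (convex_ball _ _).isPreconnected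
      (fun n y _ => (hasDerivAt_pow n y).smul_const (c n)) ?_
      (Metric.mem_ball_self ((norm_nonneg z).trans_lt hzr)) ?_ (by simpa using hzr)
    · refine h.congr_deriv ?_
      have h0 : (fun n : ℕ => z ^ n • (((n + 1 : ℕ) : ℂ) • c (n + 1))) =
          fun n : ℕ => ((((n + 1 : ℕ) : ℂ) * z ^ (n + 1 - 1)) • c (n + 1)) := by
        ext n
        rw [smul_smul, mul_comm, Nat.add_sub_cancel]
      rw [tsum_eq_zero_add' (f := fun n : ℕ => ((n : ℂ) * z ^ (n - 1)) • c n) (h0 ▸ hs'), h0]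
      simp
    · rintro (_ | n) y hy
      · simp [hu]
      · have := hbound n y (by simpa using hy)
        rwa [smul_smul, mul_comm] at this
    · refine summable_of_ne_finset_zero (s := {0}) fun n hn => ?_
      simp [zero_pow (by simpa using hn)]

/-- The holomorphic part `H` of the solution `H z * z ^ K` of `F' = (K / z + M / (z - 1)) F`
at `0`. -/
lemma exists_holomorphic_factor [FiniteDimensional ℂ 𝔸] {K : 𝔸} (hK : star K = -K) (M : 𝔸) :
    ∃ H H' : ℂ → 𝔸, H 0 = 1 ∧ (∀ z, ‖z‖ < 1 → HasDerivAt H (H' z) z) ∧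
      ∀ z, ‖z‖ < 1 → z ≠ 0 → H' z = z⁻¹ • (K * H z - H z * K) + (z - 1)⁻¹ • (M * H z) := by
  obtain ⟨c, S, m, hc0, hS0, hS, hrec, hSn, hcn⟩ := exists_coefficients hK M
  refine ⟨fun z => ∑' n, z ^ n • c n, fun z => ∑' n : ℕ, z ^ n • (((n + 1 : ℕ) : ℂ) • c (n + 1)),
    ?_, fun z hz => (hasDerivAt_tsum_pow_smul hcn hz).2.2, fun z hz hz0 => ?_⟩
  · simp only
    rw [tsum_eq_single 0 fun n hn => by simp [hn]]
    simp [hc0]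
  · obtain ⟨hs, hs', -⟩ := hasDerivAt_tsum_pow_smul hcn hz
    have hU : Summable fun n => z ^ n • S n :=
      Summable.of_norm_bounded (summable_choose_mul_geometric_of_norm_lt_one m
        (r := ‖z‖) (by simpa using hz)) fun n => by
        rw [norm_smul, norm_pow, mul_comm]
        exact mul_le_mul_of_nonneg_right (hSn n) (by positivity)
    set H := ∑' n, z ^ n • c n
    set U := ∑' n, z ^ n • S n
    have hH : HasSum (fun n => z ^ (n + 1) • c (n + 1)) (H - 1) := by
      have := (hasSum_nat_add_iff' 1).mpr hs.hasSum
      simpa [hc0] using this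
    have hUH : U = H + z • U := by
      have h1 : HasSum (fun n => z ^ (n + 1) • S (n + 1)) (U - 1) := by
        have := (hasSum_nat_add_iff' 1).mpr hU.hasSum
        simpa [hS0] using this
      have h2 : HasSum (fun n => z ^ (n + 1) • S (n + 1)) (z • U + (H - 1)) := by
        refine ((hU.hasSum.const_smul z).add hH).congr_fun ?_
        intro n
        rw [hS, smul_add, smul_smul, pow_succ']
      have := h1.unique h2
      rw [sub_eq_iff_eq_add] at this
      exact this.trans (by abel)
    have hz1 : z - 1 ≠ 0 := fun h => by
      rw [sub_eq_zero.mp h, norm_one] at hz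
      exact lt_irrefl _ hz
    have hHU : U = -((z - 1)⁻¹ • H) := by
      have : H = -((z - 1) • U) := by
        rw [sub_smul, one_smul, neg_sub, eq_sub_iff_add_eq]
        exact hUH.symm
      rw [this, smul_neg, neg_neg, smul_smul, inv_mul_cancel₀ hz1, one_smul]
    have hmain : HasSum (fun n : ℕ => z • (z ^ n • (((n + 1 : ℕ) : ℂ) • c (n + 1))))
        (K * (H - 1) - (H - 1) * K - z • (M * U)) := by
      refine (((hH.mul_left K).sub (hH.mul_right K)).sub
        ((hU.hasSum.mul_left M).const_smul z)).congr_fun ?_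
      intro n
      rw [hrec, smul_smul, ← pow_succ', smul_sub, smul_sub, mul_smul_comm, smul_mul_assoc,
        mul_smul_comm, smul_smul, ← pow_succ']
    have h := (hs'.hasSum.const_smul z).unique hmain
    have h' := congrArg (fun X => z⁻¹ • X) h
    simp only [inv_smul_smul₀ hz0] at h'
    change _ = z⁻¹ • (K * H - H * K) + (z - 1)⁻¹ • (M * H)
    refine h'.trans ?_
    rw [hHU, smul_sub, smul_smul, inv_mul_cancel₀ hz0, one_smul, mul_neg, sub_neg_eq_add,
      mul_smul_comm]
    congr 2
    noncomm_ring

end PowerSeries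

/-! ### The Knizhnik–Zamolodchikov equation for self-adjoint operators -/

section KZEquation

open Filter Topology KZ

variable {W : Type*} [NormedAddCommGroup W] [InnerProductSpace ℂ W]

lemma eqOn_const_of_hasDerivAt_zero {F : ℝ → Op W}
    (hF : ∀ x ∈ Set.Ioo (0 : ℝ) 1, HasDerivAt F 0 x) :
    ∃ C, ∀ x ∈ Set.Ioo (0 : ℝ) 1, F x = C := by
  obtain ⟨C, hC⟩ := isOpen_Ioo.exists_is_const_of_deriv_eq_zero isPreconnected_Ioo
    (fun x hx => (hF x hx).differentiableAt.differentiableWithinAt) fun x hx => (hF x hx).deriv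
  exact ⟨C, hC⟩

/-- The reflection `x ↦ 1 - x` exchanges the two singular points of the KZ equation. -/
lemma KZ.SolvesKZ.reflect {ħ : ℂ} {A B : Op W} {F : ℝ → Op W} (hF : SolvesKZ ħ A B F) :
    SolvesKZ ħ B A fun x => F (1 - x) := fun x hx => by
  have hx' : 1 - x ∈ Set.Ioo (0 : ℝ) 1 := ⟨by linarith [hx.2], by linarith [hx.1]⟩
  have h := (hF (1 - x) hx').scomp x ((hasDerivAt_id x).const_sub 1)
  refine h.congr_deriv ?_
  have e1 : (((1 - x : ℝ) : ℂ))⁻¹ = -((x : ℂ) - 1)⁻¹ := by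
    rw [← inv_neg]
    push_cast
    ring
  have e2 : (((1 - x : ℝ) : ℂ) - 1)⁻¹ = -(x : ℂ)⁻¹ := by
    rw [← inv_neg]
    push_cast
    ring
  rw [e1, e2, neg_one_smul, ← neg_mul, ← smul_neg]
  congr 2
  rw [neg_smul, neg_smul]
  abel

variable [FiniteDimensional ℂ W]

instance : FiniteDimensional ℂ (Op W) :=
  Module.Finite.equiv (LinearMap.toContinuousLinearMap : (W →ₗ[ℂ] W) ≃ₗ[ℂ] (W →L[ℂ] W))

lemma Op.mul_eq_one_symm {S T : Op W} (h : S * T = 1) : T * S = 1 := by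
  have h' : (S : W →ₗ[ℂ] W) * (T : W →ₗ[ℂ] W) = 1 := by
    ext v
    exact congrArg (fun R : Op W => R v) h
  have := mul_eq_one_comm.mp h'
  ext v
  exact congrArg (fun R : W →ₗ[ℂ] W => R v) this

instance : CompleteSpace W := FiniteDimensional.complete ℂ W

lemma star_opPow {K : Op W} (hK : star K = -K) (x : ℝ) :
    star (opPow x K) = opPow x (-K) := by
  rw [opPow, opPow, NormedSpace.star_exp, star_smul, hK]
  simp

lemma opPow_neg_mul_opPow (x : ℝ) (K : Op W) : opPow x (-K) * opPow x K = 1 := by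
  let _ : NormedAlgebra ℚ (Op W) := NormedAlgebra.restrictScalars ℚ ℂ (Op W)
  rw [opPow, opPow, ← NormedSpace.exp_add_of_commute, smul_neg, neg_add_cancel,
    NormedSpace.exp_zero]
  exact (((Commute.refl K).neg_left).smul_left _).smul_right _

lemma opPow_mul_opPow_neg (x : ℝ) (K : Op W) : opPow x K * opPow x (-K) = 1 := by
  simpa using opPow_neg_mul_opPow x (-K)

lemma hasDerivAt_opPow {x : ℝ} (hx : x ≠ 0) (K : Op W) :
    HasDerivAt (fun y => opPow y K) ((x : ℂ)⁻¹ • (K * opPow x K)) x := by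
  have h1 : HasDerivAt (fun y : ℝ => ((Real.log y : ℝ) : ℂ)) ((x : ℂ)⁻¹) x := by
    simpa using (Real.hasDerivAt_log hx).ofReal_comp
  exact (hasDerivAt_exp_smul_const' (𝕂 := ℂ) K ((Real.log x : ℝ) : ℂ)).scomp x h1

/-- A function with the given regular singular behaviour at `0`: `F x * x ^ (-K)` extends
holomorphically to the unit disc with value `1` at `0`. Conjugating an operator that commutes with
`K` by such functions recovers that operator in the limit `x → 0`. -/
lemma tendsto_star_mul_mul {K C : Op W} (hK : star K = -K) (hC : Commute C K) {F F' : ℝ → Op W}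
    (hF : ExtendsToDisc fun x => F x * opPow x (-K))
    (hF' : ExtendsToDisc fun x => F' x * opPow x (-K)) :
    Tendsto (fun x => star (F x) * C * F' x) (𝓝[>] 0) (𝓝 C) := by
  obtain ⟨H, hH, hH0, hHF⟩ := hF
  obtain ⟨H', hH', hH'0, hHF'⟩ := hF'
  have hcont : ∀ H : ℂ → Op W, DifferentiableOn ℂ H (Metric.ball 0 1) → H 0 = 1 →
      Tendsto (fun x : ℝ => H x) (𝓝[>] 0) (𝓝 1) := fun H hH h0 => by
    have h1 : ContinuousAt H ((0 : ℝ) : ℂ) := by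
      simpa using (hH.differentiableAt (Metric.ball_mem_nhds 0 one_pos)).continuousAt
    have h2 : Tendsto (fun x : ℝ => H x) (𝓝 0) (𝓝 (H ((0 : ℝ) : ℂ))) :=
      h1.tendsto.comp Complex.continuous_ofReal.continuousAt
    rw [Complex.ofReal_zero, h0] at h2
    exact h2.mono_left nhdsWithin_le_nhds
  have hlim : Tendsto (fun x : ℝ => ‖star (H x) * C * H' x - C‖) (𝓝[>] 0) (𝓝 0) := by
    have h := (((hcont H hH hH0).star.mul_const C).mul (hcont H' hH' hH'0)).sub_const C
    simpa using h.norm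
  rw [tendsto_iff_norm_sub_tendsto_zero]
  refine squeeze_zero' (Eventually.of_forall fun _ => norm_nonneg _) ?_ hlim
  filter_upwards [Ioo_mem_nhdsGT (zero_lt_one' ℝ)] with x hx
  have e : ∀ (F : ℝ → Op W) (H : ℂ → Op W), H x = F x * opPow x (-K) →
      F x = H x * opPow x K := fun F H h => by
    rw [h, mul_assoc, opPow_neg_mul_opPow, mul_one]
  have hCx : Commute C (opPow x K) := (hC.smul_right _).exp_right
  have hnorm : ∀ K : Op W, star K = -K → ‖opPow x K‖ ≤ 1 := fun K hK => by
    have h : ‖opPow x K‖ * ‖opPow x K‖ ≤ 1 := by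
      rw [← CStarRing.norm_star_mul_self, star_opPow hK, opPow_neg_mul_opPow]
      exact CStarRing.norm_one_le' (Op W)
    nlinarith [norm_nonneg (opPow x K)]
  have key : star (F x) * C * F' x - C =
      opPow x (-K) * (star (H x) * C * H' x - C) * opPow x K := by
    have hCC : opPow x (-K) * C * opPow x K = C := by
      rw [mul_assoc, hCx.eq, ← mul_assoc, opPow_neg_mul_opPow, one_mul]
    rw [e F H (hHF x hx), e F' H' (hHF' x hx), star_mul, star_opPow hK, mul_sub, sub_mul, hCC]
    simp only [mul_assoc]
  rw [key]
  calc _ ≤ ‖opPow x (-K)‖ * ‖star (H x) * C * H' x - C‖ * ‖opPow x K‖ :=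
        (norm_mul_le _ _).trans (mul_le_mul_of_nonneg_right (norm_mul_le _ _) (norm_nonneg _))
    _ ≤ 1 * ‖star (H x) * C * H' x - C‖ * 1 :=
        mul_le_mul (mul_le_mul_of_nonneg_right (hnorm _ (by rw [star_neg, hK])) (norm_nonneg _))
          (hnorm K hK) (norm_nonneg _) (by positivity)
    _ = _ := by ring

/-- The coefficient of the KZ equation. -/
def kzCoeff (ħ : ℂ) (A B : Op W) (x : ℝ) : Op W :=
  ħ • (((x : ℂ)⁻¹) • A + ((x : ℂ) - 1)⁻¹ • B)

lemma star_kzCoeff {ħ : ℂ} (hħ : star ħ = -ħ) {A B : Op W} (hA : IsSelfAdjoint A)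
    (hB : IsSelfAdjoint B) (x : ℝ) : star (kzCoeff ħ A B x) = -kzCoeff ħ A B x := by
  have h1 : star ((x : ℂ)⁻¹) = (x : ℂ)⁻¹ := by simp
  have h2 : star (((x : ℂ) - 1)⁻¹) = ((x : ℂ) - 1)⁻¹ := by simp
  rw [kzCoeff, star_smul, star_add, star_smul, star_smul, hA.star_eq, hB.star_eq, hħ, h1, h2,
    neg_smul]

lemma star_smul_selfAdjoint {ħ : ℂ} (hħ : star ħ = -ħ) {A : Op W} (hA : IsSelfAdjoint A) :
    star (ħ • A) = -(ħ • A) := by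
  rw [star_smul, hħ, hA.star_eq, neg_smul]

/-- The derivative of `F⋆ C F'` for two solutions of the KZ equation. -/
lemma hasDerivAt_star_mul_mul {ħ : ℂ} (hħ : star ħ = -ħ) {A B : Op W} (hA : IsSelfAdjoint A)
    (hB : IsSelfAdjoint B) {F F' : ℝ → Op W} (hF : SolvesKZ ħ A B F) (hF' : SolvesKZ ħ A B F')
    (C : Op W) {x : ℝ} (hx : x ∈ Set.Ioo (0 : ℝ) 1) :
    HasDerivAt (fun x => star (F x) * C * F' x)
      (star (F x) * (C * kzCoeff ħ A B x - kzCoeff ħ A B x * C) * F' x) x := by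
  have h := ((hF x hx).star.mul_const C).mul (hF' x hx)
  refine h.congr_deriv ?_
  change star (kzCoeff ħ A B x * F x) * C * F' x + star (F x) * C * (kzCoeff ħ A B x * F' x) = _
  rw [star_mul, star_kzCoeff hħ hA hB]
  noncomm_ring

/-- Two normalized solutions at `0` satisfy `F⋆ F' = 1`; for `F' = F` this is unitarity, and in
general it then gives uniqueness. -/
lemma star_mul_eq_one {ħ : ℂ} (hħ : star ħ = -ħ) {A B : Op W} (hA : IsSelfAdjoint A)
    (hB : IsSelfAdjoint B) {F F' : ℝ → Op W} (hF : SolvesKZ ħ A B F) (hF' : SolvesKZ ħ A B F')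
    (hE : ExtendsToDisc fun x => F x * opPow x (-(ħ • A)))
    (hE' : ExtendsToDisc fun x => F' x * opPow x (-(ħ • A))) {x : ℝ}
    (hx : x ∈ Set.Ioo (0 : ℝ) 1) : star (F x) * F' x = 1 := by
  obtain ⟨C, hC⟩ := eqOn_const_of_hasDerivAt_zero (F := fun x => star (F x) * 1 * F' x)
    fun y hy => by simpa using hasDerivAt_star_mul_mul hħ hA hB hF hF' 1 hy
  have h := tendsto_star_mul_mul (star_smul_selfAdjoint hħ hA) (Commute.one_left _) hE hE'
  have h' : Tendsto (fun x => star (F x) * 1 * F' x) (𝓝[>] 0) (𝓝 C) :=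
    tendsto_const_nhds.congr' <| by
      filter_upwards [Ioo_mem_nhdsGT (zero_lt_one' ℝ)] with y hy using (hC y hy).symm
  have h1 := hC x hx
  rw [tendsto_nhds_unique h' h, mul_one] at h1
  exact h1

lemma eq_of_normalized {ħ : ℂ} (hħ : star ħ = -ħ) {A B : Op W} (hA : IsSelfAdjoint A)
    (hB : IsSelfAdjoint B) {F F' : ℝ → Op W} (hF : SolvesKZ ħ A B F) (hF' : SolvesKZ ħ A B F')
    (hE : ExtendsToDisc fun x => F x * opPow x (-(ħ • A)))
    (hE' : ExtendsToDisc fun x => F' x * opPow x (-(ħ • A))) {x : ℝ}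
    (hx : x ∈ Set.Ioo (0 : ℝ) 1) : F x = F' x := by
  have h1 := Op.mul_eq_one_symm (star_mul_eq_one hħ hA hB hF hF hE hE hx)
  have h2 := star_mul_eq_one hħ hA hB hF hF' hE hE' hx
  calc F x = F x * (star (F x) * F' x) := by rw [h2, mul_one]
    _ = F' x := by rw [← mul_assoc, h1, one_mul]

lemma exists_normalized_solution {ħ : ℂ} (hħ : star ħ = -ħ) {A : Op W} (hA : IsSelfAdjoint A)
    (B : Op W) : ∃ F : ℝ → Op W, SolvesKZ ħ A B F ∧
      ExtendsToDisc fun x => F x * opPow x (-(ħ • A)) := by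
  obtain ⟨H, H', hH0, hH, hH'⟩ := exists_holomorphic_factor (star_smul_selfAdjoint hħ hA) (ħ • B)
  refine ⟨fun x => H x * opPow x (ħ • A), fun x hx => ?_, H, fun z hz =>
    (hH z (by simpa using hz)).differentiableAt.differentiableWithinAt, hH0, fun x hx => ?_⟩
  · have hx1 : ‖(x : ℂ)‖ < 1 := by
      rw [Complex.norm_real, Real.norm_of_nonneg hx.1.le]
      exact hx.2
    have hx0 : (x : ℂ) ≠ 0 := Complex.ofReal_ne_zero.mpr hx.1.ne'
    have hHx : HasDerivAt (fun y : ℝ => H y) (H' x) x := by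
      have h := (hH x hx1).scomp x (hasDerivAt_id x).ofReal_comp
      rw [Complex.ofReal_one, one_smul] at h
      exact h
    refine (hHx.mul (hasDerivAt_opPow hx.1.ne' (ħ • A))).congr_deriv ?_
    rw [hH' x hx1 hx0]
    simp only [mul_smul_comm, smul_mul_assoc, add_mul, smul_add, sub_mul, smul_sub, mul_assoc,
      smul_comm ħ]
    abel
  · simp only [mul_assoc, opPow_mul_opPow_neg, mul_one]

/-- Existence and uniqueness of the KZ associator of a pair of self-adjoint operators. -/
lemma existsUnique_isKZAssociator {ħ : ℂ} (hħ : star ħ = -ħ) {A B : Op W} (hA : IsSelfAdjoint A)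
    (hB : IsSelfAdjoint B) : ∃! Φ, IsKZAssociator ħ A B Φ := by
  have hhalf : (1 / 2 : ℝ) ∈ Set.Ioo (0 : ℝ) 1 := ⟨by norm_num, by norm_num⟩
  have hmem : ∀ {x : ℝ}, x ∈ Set.Ioo (0 : ℝ) 1 → 1 - x ∈ Set.Ioo (0 : ℝ) 1 := fun hx =>
    ⟨by linarith [hx.2], by linarith [hx.1]⟩
  have hunit : ∀ {G : ℝ → Op W}, SolvesKZ ħ A B G →
      ExtendsToDisc (fun x => G (1 - x) * opPow x (-(ħ • B))) →
      ∀ x ∈ Set.Ioo (0 : ℝ) 1, star (G x) * G x = 1 := fun {G} hG hE x hx => by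
    simpa using star_mul_eq_one hħ hB hA hG.reflect hG.reflect hE hE (hmem hx)
  obtain ⟨G₀, h₀, hE₀⟩ := exists_normalized_solution hħ hA B
  obtain ⟨F, hF, hEF⟩ := exists_normalized_solution hħ hB A
  set G₁ : ℝ → Op W := fun x => F (1 - x) with hG₁
  have h₁ : SolvesKZ ħ A B G₁ := hF.reflect
  have hE₁ : ExtendsToDisc (fun x => G₁ (1 - x) * opPow x (-(ħ • B))) := by
    simpa [hG₁] using hEF
  obtain ⟨Φ, hΦ⟩ := eqOn_const_of_hasDerivAt_zero (F := fun x => star (G₁ x) * 1 * G₀ x)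
    fun y hy => by simpa using hasDerivAt_star_mul_mul hħ hA hB h₁ h₀ 1 hy
  refine ⟨Φ, ⟨G₀, G₁, h₀, h₁, hE₀, hE₁, fun x hx => ?_⟩, ?_⟩
  · rw [← hΦ x hx, mul_one, ← mul_assoc, Op.mul_eq_one_symm (hunit h₁ hE₁ x hx), one_mul]
  · rintro Ψ ⟨K₀, K₁, hK₀, hK₁, hEK₀, hEK₁, hΨ⟩
    have e₀ := eq_of_normalized hħ hA hB h₀ hK₀ hE₀ hEK₀ hhalf
    have e₁ := eq_of_normalized hħ hB hA h₁.reflect hK₁.reflect hE₁ hEK₁ (hmem hhalf)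
    rw [sub_sub_cancel] at e₁
    rw [← hΦ _ hhalf, mul_one, e₀, hΨ _ hhalf, e₁, ← mul_assoc, hunit hK₁ hEK₁ _ hhalf, one_mul]

/-- The commutator estimate. With `G₀`, `G₁` the normalized solutions at the two singular points,
the function `G₁⋆ D G₀ + (1 - x) G₁⋆ E G₀` has derivative `-G₁⋆ E G₀`, because `[D, A] = -[E, A]`,
`[D, B] = 0` and `[E, B] = -[E, A]`; it tends to `Φ (D + E)` at `0` and to `D Φ` at `1`. -/
lemma norm_commutator_associator_le {ħ : ℂ} (hħ : star ħ = -ħ) {A B D E Φ : Op W}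
    (hA : IsSelfAdjoint A) (hB : IsSelfAdjoint B) (hDB : Commute D B) (hDEA : Commute (E + D) A)
    (hE : Commute E (A + B)) (hΦ : IsKZAssociator ħ A B Φ) : ‖D * Φ - Φ * D‖ ≤ 2 * ‖E‖ := by
  obtain ⟨G₀, G₁, h₀, h₁, hE₀, hE₁, hG⟩ := hΦ
  have hu₀ : ∀ x ∈ Set.Ioo (0 : ℝ) 1, star (G₀ x) * G₀ x = 1 := fun x hx =>
    star_mul_eq_one hħ hA hB h₀ h₀ hE₀ hE₀ hx
  have hmem : ∀ {x : ℝ}, x ∈ Set.Ioo (0 : ℝ) 1 → 1 - x ∈ Set.Ioo (0 : ℝ) 1 := fun hx =>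
    ⟨by linarith [hx.2], by linarith [hx.1]⟩
  have hu₁ : ∀ x ∈ Set.Ioo (0 : ℝ) 1, star (G₁ x) * G₁ x = 1 := fun x hx => by
    simpa using star_mul_eq_one hħ hB hA h₁.reflect h₁.reflect hE₁ hE₁ (hmem hx)
  have hG' : ∀ x ∈ Set.Ioo (0 : ℝ) 1, star (G₁ x) = Φ * star (G₀ x) := fun x hx => by
    have : Φ = star (G₁ x) * G₀ x := by rw [hG x hx, ← mul_assoc, hu₁ x hx, one_mul]
    rw [this, mul_assoc, Op.mul_eq_one_symm (hu₀ x hx), mul_one]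
  have hnorm : ∀ X : Op W, star X * X = 1 → ‖X‖ ≤ 1 := fun X hX => by
    have h : ‖X‖ * ‖X‖ ≤ 1 := by
      rw [← CStarRing.norm_star_mul_self, hX]
      exact CStarRing.norm_one_le' (Op W)
    nlinarith [norm_nonneg X]
  have hconj : ∀ x ∈ Set.Ioo (0 : ℝ) 1, ∀ X : Op W, ‖star (G₁ x) * X * G₀ x‖ ≤ ‖X‖ :=
    fun x hx X => by
      calc _ ≤ ‖star (G₁ x)‖ * ‖X‖ * ‖G₀ x‖ := (norm_mul_le _ _).trans
            (mul_le_mul_of_nonneg_right (norm_mul_le _ _) (norm_nonneg _))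
        _ ≤ 1 * ‖X‖ * 1 := by
            rw [norm_star]
            exact mul_le_mul (mul_le_mul_of_nonneg_right (hnorm _ (hu₁ x hx)) (norm_nonneg _))
              (hnorm _ (hu₀ x hx)) (norm_nonneg _) (by positivity)
        _ = ‖X‖ := by ring
  set Y : ℝ → Op W := fun x => star (G₁ x) * E * G₀ x with hY
  set Z : ℝ → Op W := fun x => star (G₁ x) * D * G₀ x + ((1 - x : ℝ) : ℂ) • Y x with hZ
  have hZ' : ∀ x ∈ Set.Ioo (0 : ℝ) 1, HasDerivAt Z (-Y x) x := fun x hx => by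
    have d1 := hasDerivAt_star_mul_mul hħ hA hB h₁ h₀ D hx
    have d2 := hasDerivAt_star_mul_mul hħ hA hB h₁ h₀ E hx
    have d3 : HasDerivAt (fun y : ℝ => ((1 - y : ℝ) : ℂ)) ((-1 : ℝ) : ℂ) x :=
      ((hasDerivAt_id x).const_sub 1).ofReal_comp
    refine (d1.add (d3.smul d2)).congr_deriv ?_
    have hx0 : (x : ℂ) ≠ 0 := Complex.ofReal_ne_zero.mpr hx.1.ne'
    have hx1 : (x : ℂ) - 1 ≠ 0 := by
      rw [sub_ne_zero]
      exact_mod_cast hx.2.ne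
    have hcomm : D * kzCoeff ħ A B x - kzCoeff ħ A B x * D +
        ((1 - x : ℝ) : ℂ) • (E * kzCoeff ħ A B x - kzCoeff ħ A B x * E) = 0 := by
      have c1 : D * A - A * D = -(E * A - A * E) := by
        have := hDEA.eq
        rw [add_mul, mul_add] at this
        rw [eq_neg_iff_add_eq_zero, ← sub_eq_zero.mpr this]
        abel
      have c2 : E * B - B * E = -(E * A - A * E) := by
        have := hE.eq
        rw [add_mul, mul_add] at this
        rw [eq_neg_iff_add_eq_zero, ← sub_eq_zero.mpr this]
        abel
      have c3 : ∀ X : Op W, X * kzCoeff ħ A B x - kzCoeff ħ A B x * X =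
          (ħ * (x : ℂ)⁻¹) • (X * A - A * X) + (ħ * ((x : ℂ) - 1)⁻¹) • (X * B - B * X) :=
        fun X => by
          simp only [kzCoeff, smul_add, mul_add, add_mul, mul_smul_comm, smul_mul_assoc, smul_smul,
            smul_sub]
          abel
      rw [c3, c3, c1, c2, sub_eq_zero.mpr hDB.eq, smul_zero, add_zero, smul_neg, smul_neg,
        ← neg_smul, ← neg_smul, ← add_smul, smul_smul, ← add_smul]
      convert zero_smul ℂ _ using 2
      push_cast
      field_simp
      ring
    have hfac : star (G₁ x) * (D * kzCoeff ħ A B x - kzCoeff ħ A B x * D) * G₀ x +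
        ((1 - x : ℝ) : ℂ) • (star (G₁ x) * (E * kzCoeff ħ A B x - kzCoeff ħ A B x * E) * G₀ x) =
        0 := by
      rw [← smul_mul_assoc, ← mul_smul_comm, ← add_mul, ← mul_add, hcomm, mul_zero, zero_mul]
    rw [← add_assoc, hfac, zero_add]
    push_cast
    rw [neg_one_smul]
  have hlip : ∀ u ∈ Set.Ioo (0 : ℝ) 1, ∀ v ∈ Set.Ioo (0 : ℝ) 1, ‖Z v - Z u‖ ≤ ‖E‖ :=
    fun u hu v hv => by
      have h := (convex_Ioo (0 : ℝ) 1).norm_image_sub_le_of_norm_hasDerivWithin_le (C := ‖E‖)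
        (fun x hx => (hZ' x hx).hasDerivWithinAt)
        (fun x hx => by rw [norm_neg]; exact hconj x hx E) hu hv
      refine h.trans (mul_le_of_le_one_right (norm_nonneg _) ?_)
      rw [Real.norm_eq_abs, abs_le]
      constructor <;> linarith [hu.1, hu.2, hv.1, hv.2]
  have hYsmall : ∀ f : ℝ → ℝ, Tendsto f (𝓝[>] 0) (𝓝 0) →
      (∀ x ∈ Set.Ioo (0 : ℝ) 1, f x ∈ Set.Icc (0 : ℝ) 1 ) → ∀ g : ℝ → ℝ,
      (∀ x ∈ Set.Ioo (0 : ℝ) 1, g x ∈ Set.Ioo (0 : ℝ) 1) →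
      Tendsto (fun x => ((f x : ℝ) : ℂ) • Y (g x)) (𝓝[>] 0) (𝓝 0) := fun f hf hf' g hg => by
    rw [tendsto_zero_iff_norm_tendsto_zero]
    refine squeeze_zero' (Eventually.of_forall fun _ => norm_nonneg _) ?_
      (by simpa using hf.mul_const ‖E‖)
    filter_upwards [Ioo_mem_nhdsGT (zero_lt_one' ℝ)] with x hx
    rw [norm_smul, Complex.norm_real, Real.norm_of_nonneg (hf' x hx).1]
    exact mul_le_mul_of_nonneg_left (hconj _ (hg x hx) E) (hf' x hx).1
  have hid : Tendsto (fun x : ℝ => x) (𝓝[>] 0) (𝓝 0) := tendsto_id.mono_left nhdsWithin_le_nhds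
  have lim0 : Tendsto Z (𝓝[>] 0) (𝓝 (Φ * (E + D))) := by
    have h1 := (tendsto_star_mul_mul (star_smul_selfAdjoint hħ hA)
      (hDEA.smul_right ħ) hE₀ hE₀).const_mul Φ
    have h2 := hYsmall (fun x => x) hid (fun x hx => ⟨hx.1.le, hx.2.le⟩) (fun x => x)
      (fun x hx => hx)
    have h3 := h1.sub h2
    rw [sub_zero] at h3
    refine h3.congr' ?_
    filter_upwards [Ioo_mem_nhdsGT (zero_lt_one' ℝ)] with x hx
    rw [hZ]
    simp only [hY, hG' x hx]
    push_cast
    rw [sub_smul, one_smul]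
    noncomm_ring
  have lim1 : Tendsto (fun y => Z (1 - y)) (𝓝[>] 0) (𝓝 (D * Φ)) := by
    have h1 := (tendsto_star_mul_mul (star_smul_selfAdjoint hħ hB)
      (hDB.smul_right ħ) hE₁ hE₁).mul_const Φ
    have h2 := hYsmall (fun x => x) hid (fun x hx => ⟨hx.1.le, hx.2.le⟩) (fun x => 1 - x)
      (fun x hx => hmem hx)
    have h3 := h1.add h2
    rw [add_zero] at h3
    refine h3.congr' ?_
    filter_upwards [Ioo_mem_nhdsGT (zero_lt_one' ℝ)] with x hx
    simp only [hZ, sub_sub_cancel]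
    rw [hG _ (hmem hx)]
    simp only [mul_assoc]
  have hle : ‖D * Φ - Φ * (E + D)‖ ≤ ‖E‖ := by
    refine le_of_tendsto (lim1.sub lim0).norm ?_
    filter_upwards [Ioo_mem_nhdsGT (zero_lt_one' ℝ)] with x hx
    exact hlip x hx _ (hmem hx)
  have hΦnorm : ‖Φ‖ ≤ 1 := by
    have hhalf : (1 / 2 : ℝ) ∈ Set.Ioo (0 : ℝ) 1 := ⟨by norm_num, by norm_num⟩
    have : Φ = star (G₁ (1 / 2)) * 1 * G₀ (1 / 2) := by
      rw [hG _ hhalf, mul_one, ← mul_assoc, hu₁ _ hhalf, one_mul]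
    rw [this]
    exact (hconj _ hhalf 1).trans (CStarRing.norm_one_le' (Op W))
  have e : D * Φ - Φ * D = (D * Φ - Φ * (E + D)) + Φ * E := by noncomm_ring
  rw [e]
  have := (norm_add_le (D * Φ - Φ * (E + D)) (Φ * E)).trans
    (add_le_add hle ((norm_mul_le _ _).trans (mul_le_of_le_one_left (norm_nonneg _) hΦnorm)))
  linarith

end KZEquation

/-! ### The invariant form and the spin representation -/

section Spin

open KZ

variable {L : Type*} [LieRing L] [LieAlgebra ℝ L]

lemma incl_lie (y z : L) : (incl ⁅y, z⁆ : Cplx L) = ⁅(incl y : Cplx L), (incl z : Cplx L)⁆ := by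
  simp [incl]

lemma invForm_lie (c : ℝ) (y z w : L) :
    invForm L c (incl ⁅y, z⁆) (incl w) = invForm L c (incl y) (incl ⁅z, w⁆) := by
  simp only [invForm, LinearMap.smul_apply, incl_lie]
  rw [LieModule.traceForm_apply_lie_apply]

lemma invForm_comm (c : ℝ) (y z : Cplx L) : invForm L c y z = invForm L c z y := by
  simp only [invForm, LinearMap.smul_apply]
  rw [LieModule.traceForm_comm]

variable {κ : Type*} [Fintype κ] {x : Module.Basis κ ℝ L} {c : ℝ}
  {S : Type*} [NormedAddCommGroup S] [InnerProductSpace ℂ S]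

lemma four_smul_spin (s : CliffordStarRep L c S) (y : L) :
    (4 : ℝ) • s.spin x y = ∑ k, s.gamma (x k) * s.gamma ⁅y, x k⁆ := by
  have h : adTilde c x y = (1 / 4 : ℂ) • ∑ k, gam L c (x k) * gam L c ⁅y, x k⁆ := by
    simp [adTilde]
  change (4 : ℝ) • s.toAlgHom (adTilde c x y) =
    ∑ k, s.toAlgHom (gam L c (x k)) * s.toAlgHom (gam L c ⁅y, x k⁆)
  rw [h, map_smul, map_sum]
  simp only [map_mul]
  rw [← Complex.coe_smul, smul_smul]
  norm_num

lemma star_gamma [CompleteSpace S] (s : CliffordStarRep L c S) (y : L) :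
    star (s.gamma y) = -s.gamma y := by
  refine ((ContinuousLinearMap.eq_adjoint_iff _ _).mpr fun v w => ?_).symm
  change inner ℂ (-(s.toAlgHom (gam L c y) v)) w = inner ℂ v (s.toAlgHom (gam L c y) w)
  rw [inner_neg_left, s.skew, neg_neg]

variable [DecidableEq κ]

lemma invForm_eq_basisForm
    (hx : ∀ k l, invForm L c (incl (x k)) (incl (x l)) = if k = l then -1 else 0) (y z : L) :
    invForm L c (incl y) (incl z) = (basisForm x y z : ℂ) := by
  have h : ∀ y : L, (incl y : Cplx L) = ∑ k, (x.repr y k : ℂ) • incl (x k) := fun y => by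
    conv_lhs => rw [← x.sum_repr y]
    simp only [map_sum, map_smul]
    rfl
  rw [h y, h z]
  simp only [map_sum, map_smul, LinearMap.sum_apply, LinearMap.smul_apply, hx, basisForm]
  simp [Finset.sum_neg_distrib, mul_comm]

lemma adSkew_of_invForm
    (hx : ∀ k l, invForm L c (incl (x k)) (incl (x l)) = if k = l then -1 else 0) :
    AdSkew x := fun y k l => by
  have h1 := invForm_lie c (x k) y (x l)
  rw [invForm_eq_basisForm hx, invForm_eq_basisForm hx, Complex.ofReal_inj, ← lie_skew,
    basisForm_comm, basisForm_basis, basisForm_basis, map_neg, Finsupp.neg_apply, neg_neg] at h1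
  exact h1

lemma gamma_mul_gamma_add
    (hx : ∀ k l, invForm L c (incl (x k)) (incl (x l)) = if k = l then -1 else 0)
    (s : CliffordStarRep L c S) (y z : L) :
    s.gamma y * s.gamma z + s.gamma z * s.gamma y = (2 * basisForm x y z) • (1 : S →L[ℂ] S) := by
  have h : gam L c y * gam L c z + gam L c z * gam L c y =
      algebraMap ℂ _ (2 * (basisForm x y z : ℂ)) := by
    have hp : QuadraticMap.polar (quadForm L c) (incl y) (incl z) =
        2 * (basisForm x y z : ℂ) := by
      rw [quadForm, LinearMap.BilinMap.polar_toQuadraticMap, invForm_comm c (incl z),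
        invForm_eq_basisForm hx, two_mul]
    rw [← hp]
    exact CliffordAlgebra.ι_mul_ι_add_swap _ _
  change s.toAlgHom (gam L c y) * s.toAlgHom (gam L c z) +
    s.toAlgHom (gam L c z) * s.toAlgHom (gam L c y) = _
  rw [← map_mul s.toAlgHom, ← map_mul s.toAlgHom, ← map_add s.toAlgHom, h, AlgHom.commutes,
    Algebra.algebraMap_eq_smul_one]
  ext v
  simp [← Complex.coe_smul]

/-- The spin representation acts by skew-adjoint operators. -/
lemma star_spin [CompleteSpace S]
    (hx : ∀ k l, invForm L c (incl (x k)) (incl (x l)) = if k = l then -1 else 0)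
    (s : CliffordStarRep L c S) (y : L) : star (s.spin x y) = -s.spin x y := by
  have h : star ((4 : ℝ) • s.spin x y) = -((4 : ℝ) • s.spin x y) := by
    rw [four_smul_spin, star_sum, ← Finset.sum_neg_distrib]
    refine Finset.sum_congr rfl fun k _ => ?_
    have h0 : x.repr ⁅y, x k⁆ k = 0 := by
      have := adSkew_of_invForm hx y k k
      linarith
    have h1 := gamma_mul_gamma_add hx s (x k) ⁅y, x k⁆
    rw [basisForm_basis, h0, neg_zero, mul_zero, zero_smul] at h1
    rw [star_mul, star_gamma, star_gamma, neg_mul_neg]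
    exact eq_neg_of_add_eq_zero_right h1
  have h4 : (4 : ℝ) • star (s.spin x y) = (4 : ℝ) • -s.spin x y := by
    rw [smul_neg, ← h, star_smul]
    rfl
  exact smul_right_injective _ (by norm_num : (4 : ℝ) ≠ 0) h4

end Spin

/-! ### Operators on tensor products -/

section Legs

open KZ TensorProduct

variable {V₁ V₂ V₃ : Type*} [NormedAddCommGroup V₁] [InnerProductSpace ℂ V₁]
  [NormedAddCommGroup V₂] [InnerProductSpace ℂ V₂]
  [NormedAddCommGroup V₃] [InnerProductSpace ℂ V₃]

variable (V₁ V₂) in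
/-- The embedding `T ↦ T ⊗ 1` of operator algebras. -/
def rTensorHom : Op V₁ →ₐ[ℂ] Op (V₁ ⊗[ℂ] V₂) :=
  AlgHom.ofLinearMap
    { toFun := fun T => T.rTensor V₂
      map_add' := ContinuousLinearMap.rTensor_add V₂
      map_smul' := ContinuousLinearMap.rTensor_smul V₂ }
    (ContinuousLinearMap.rTensor_one V₂) (ContinuousLinearMap.rTensor_mul V₂)

variable (V₁ V₂) in
/-- The embedding `T ↦ 1 ⊗ T` of operator algebras. -/
def lTensorHom : Op V₂ →ₐ[ℂ] Op (V₁ ⊗[ℂ] V₂) :=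
  AlgHom.ofLinearMap
    { toFun := fun T => T.lTensor V₁
      map_add' := ContinuousLinearMap.lTensor_add V₁
      map_smul' := ContinuousLinearMap.lTensor_smul V₁ }
    (ContinuousLinearMap.lTensor_one V₁) (ContinuousLinearMap.lTensor_mul V₁)

lemma rTensorHom_mul_lTensorHom (T : Op V₁) (R : Op V₂) :
    rTensorHom V₁ V₂ T * lTensorHom V₁ V₂ R = mapL T R := rfl

lemma commute_rTensorHom_lTensorHom (T : Op V₁) (R : Op V₂) :
    Commute (rTensorHom V₁ V₂ T) (lTensorHom V₁ V₂ R) :=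
  (ContinuousLinearMap.lTensor_comp_rTensor R T).symm

lemma mapL_id_left (T : Op V₂) :
    mapL (ContinuousLinearMap.id ℂ V₁) T = lTensorHom V₁ V₂ T :=
  (ContinuousLinearMap.lTensor_eq_mapL V₁ T).symm

lemma mapL_id_right (T : Op V₁) :
    mapL T (ContinuousLinearMap.id ℂ V₂) = rTensorHom V₁ V₂ T :=
  (ContinuousLinearMap.rTensor_eq_mapL V₂ T).symm

lemma star_rTensorHom [FiniteDimensional ℂ V₁] [FiniteDimensional ℂ V₂] (T : Op V₁) :
    star (rTensorHom V₁ V₂ T) = rTensorHom V₁ V₂ (star T) :=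
  ContinuousLinearMap.adjoint_rTensor V₂ T

lemma star_lTensorHom [FiniteDimensional ℂ V₁] [FiniteDimensional ℂ V₂] (T : Op V₂) :
    star (lTensorHom V₁ V₂ T) = lTensorHom V₁ V₂ (star T) :=
  ContinuousLinearMap.adjoint_lTensor V₁ T

variable (V₁ V₂ V₃) in
/-- Operators on the first leg of a threefold tensor product. -/
def leg₁ : Op V₁ →ₐ[ℂ] Op (V₁ ⊗[ℂ] (V₂ ⊗[ℂ] V₃)) := rTensorHom V₁ (V₂ ⊗[ℂ] V₃)

variable (V₁ V₂ V₃) in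
/-- Operators on the second leg of a threefold tensor product. -/
def leg₂ : Op V₂ →ₐ[ℂ] Op (V₁ ⊗[ℂ] (V₂ ⊗[ℂ] V₃)) :=
  (lTensorHom V₁ (V₂ ⊗[ℂ] V₃)).comp (rTensorHom V₂ V₃)

variable (V₁ V₂ V₃) in
/-- Operators on the third leg of a threefold tensor product. -/
def leg₃ : Op V₃ →ₐ[ℂ] Op (V₁ ⊗[ℂ] (V₂ ⊗[ℂ] V₃)) :=
  (lTensorHom V₁ (V₂ ⊗[ℂ] V₃)).comp (lTensorHom V₂ V₃)

lemma commute_leg₁_leg₂ (T : Op V₁) (R : Op V₂) : Commute (leg₁ V₁ V₂ V₃ T) (leg₂ V₁ V₂ V₃ R) :=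
  commute_rTensorHom_lTensorHom _ _

lemma commute_leg₁_leg₃ (T : Op V₁) (R : Op V₃) : Commute (leg₁ V₁ V₂ V₃ T) (leg₃ V₁ V₂ V₃ R) :=
  commute_rTensorHom_lTensorHom _ _

lemma commute_leg₂_leg₃ (T : Op V₂) (R : Op V₃) : Commute (leg₂ V₁ V₂ V₃ T) (leg₃ V₁ V₂ V₃ R) :=
  (commute_rTensorHom_lTensorHom T R).map (lTensorHom V₁ (V₂ ⊗[ℂ] V₃))

variable {L : Type*} [AddCommGroup L] [Module ℝ L] {κ : Type*} [Fintype κ] (x : κ → L)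
  (ρ₁ : L →ₗ[ℝ] Op V₁) (ρ₂ : L →ₗ[ℝ] Op V₂) (ρ₃ : L →ₗ[ℝ] Op V₃)

lemma t12_eq : t12 V₃ x ρ₁ ρ₂ =
    -∑ k, leg₁ V₁ V₂ V₃ (ρ₁ (x k)) * leg₂ V₁ V₂ V₃ (ρ₂ (x k)) := by
  rw [t12]
  refine congrArg Neg.neg (Finset.sum_congr rfl fun k _ => ?_)
  rw [mapL_id_right]
  rfl

lemma t23_eq : t23 V₁ x ρ₂ ρ₃ =
    -∑ k, leg₂ V₁ V₂ V₃ (ρ₂ (x k)) * leg₃ V₁ V₂ V₃ (ρ₃ (x k)) := by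
  rw [t23, mapL_id_left, tElt, map_neg, map_sum]
  refine congrArg Neg.neg (Finset.sum_congr rfl fun k _ => ?_)
  rw [← rTensorHom_mul_lTensorHom, map_mul]
  rfl

lemma norm_sum_le_of_intertwine {E F : Type*} [NormedAddCommGroup E] [InnerProductSpace ℂ E]
    [NormedAddCommGroup F] [InnerProductSpace ℂ F] (U : E ≃ₗᵢ[ℂ] F) (T : κ → Op E) (R : κ → Op F)
    (h : ∀ k w, U (T k w) = R k (U w)) : ‖∑ k, T k‖ ≤ ‖∑ k, R k‖ := by
  have h' : ∀ w, U ((∑ k, T k) w) = (∑ k, R k) (U w) := fun w => by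
    simp only [sum_apply, map_sum, h]
  refine ContinuousLinearMap.opNorm_le_bound _ (norm_nonneg _) fun w => ?_
  rw [← U.norm_map, h', ← U.norm_map w]
  exact ContinuousLinearMap.le_opNorm _ _

/-- Inserting a leg in the middle does not increase the norm of `t`. -/
lemma norm_t13_le : ‖∑ k, leg₁ V₁ V₂ V₃ (ρ₁ (x k)) * leg₃ V₁ V₂ V₃ (ρ₃ (x k))‖ ≤
    ‖tElt x ρ₁ ρ₃‖ := by
  set U : V₁ ⊗[ℂ] (V₂ ⊗[ℂ] V₃) ≃ₗᵢ[ℂ] V₂ ⊗[ℂ] (V₁ ⊗[ℂ] V₃) :=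
    ((assocIsometry ℂ V₁ V₂ V₃).symm.trans
      ((commIsometry ℂ V₁ V₂).rTensor V₃)).trans (assocIsometry ℂ V₂ V₁ V₃) with hU
  have hk : ∀ k w, U ((leg₁ V₁ V₂ V₃ (ρ₁ (x k)) * leg₃ V₁ V₂ V₃ (ρ₃ (x k))) w) =
      lTensorHom V₂ (V₁ ⊗[ℂ] V₃) (mapL (ρ₁ (x k)) (ρ₃ (x k))) (U w) := fun k w => by
    induction w with
    | zero => rw [map_zero, U.map_zero, map_zero]
    | add a b ha hb => rw [map_add, U.map_add, U.map_add, map_add, ha, hb]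
    | tmul a b =>
      induction b with
      | zero => rw [tmul_zero, map_zero, U.map_zero, map_zero]
      | add b d hb hd => rw [tmul_add, map_add, U.map_add, U.map_add, map_add, hb, hd]
      | tmul b d => rfl
  refine (norm_sum_le_of_intertwine U
    (fun k => leg₁ V₁ V₂ V₃ (ρ₁ (x k)) * leg₃ V₁ V₂ V₃ (ρ₃ (x k)))
    (fun k => lTensorHom V₂ (V₁ ⊗[ℂ] V₃) (mapL (ρ₁ (x k)) (ρ₃ (x k)))) hk).trans ?_
  rw [← map_sum, tElt, norm_neg]
  exact ContinuousLinearMap.norm_lTensor_le _ _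

end Legs

/-! ### The estimate for abstract representations -/

section Transport

open KZ

variable {U W : Type*} [NormedAddCommGroup U] [InnerProductSpace ℂ U]
  [NormedAddCommGroup W] [InnerProductSpace ℂ W]

instance : IsScalarTower ℝ (Op W) (Op W) := ⟨fun _ _ _ => rfl⟩

instance : SMulCommClass ℝ (Op W) (Op W) :=
  ⟨fun r T R => ContinuousLinearMap.ext fun v =>
    (LinearMap.map_smul_of_tower (T : W →ₗ[ℂ] W) r (R v)).symm⟩

variable {L : Type*} [LieRing L] [LieAlgebra ℝ L] {κ : Type*} [Fintype κ]

/-- The composition of a representation with a homomorphism of operator algebras. -/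
def transport (f : Op U →ₐ[ℂ] Op W) (ρ : L →ₗ[ℝ] Op U) : L →ₗ[ℝ] Op W :=
  f.toLinearMap.restrictScalars ℝ ∘ₗ ρ

lemma transport_apply (f : Op U →ₐ[ℂ] Op W) (ρ : L →ₗ[ℝ] Op U) (y : L) :
    transport f ρ y = f (ρ y) := rfl

lemma algHom_map_real_smul (f : Op U →ₐ[ℂ] Op W) (r : ℝ) (T : Op U) : f (r • T) = r • f T :=
  (f.toLinearMap.restrictScalars ℝ).map_smul r T

lemma transport_lie (f : Op U →ₐ[ℂ] Op W) {ρ : L →ₗ[ℝ] Op U}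
    (h : ∀ y z, ρ ⁅y, z⁆ = ρ y * ρ z - ρ z * ρ y) (y z : L) :
    transport f ρ ⁅y, z⁆ = transport f ρ y * transport f ρ z - transport f ρ z * transport f ρ y := by
  simp only [transport_apply, h, map_sub, map_mul]

lemma isSelfAdjoint_neg_sum_mul [CompleteSpace W] {T R : κ → Op W} (hT : ∀ k, star (T k) = -T k)
    (hR : ∀ k, star (R k) = -R k) (h : ∀ k, Commute (T k) (R k)) :
    IsSelfAdjoint (-∑ k, T k * R k) := by
  rw [IsSelfAdjoint, star_neg, star_sum]
  congr 1
  refine Finset.sum_congr rfl fun k _ => ?_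
  rw [star_mul, hT, hR, neg_mul_neg, (h k).eq]

variable {V₁ V₂ S : Type*} [NormedAddCommGroup V₁] [InnerProductSpace ℂ V₁]
  [NormedAddCommGroup V₂] [InnerProductSpace ℂ V₂] [NormedAddCommGroup S] [InnerProductSpace ℂ S]
  {x : Module.Basis κ ℝ L} {c : ℝ}

/-- The commutation relations behind the estimate, for commuting copies of the operator algebras
of the three legs inside one operator algebra. -/
lemma commute_relations [DecidableEq κ]
    (hx : ∀ k l, invForm L c (incl (x k)) (incl (x l)) = if k = l then -1 else 0)
    (f₁ : Op V₁ →ₐ[ℂ] Op W) (f₂ : Op V₂ →ₐ[ℂ] Op W) (f₃ : Op S →ₐ[ℂ] Op W)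
    (h₁₂ : ∀ T R, Commute (f₁ T) (f₂ R)) (h₁₃ : ∀ T R, Commute (f₁ T) (f₃ R))
    (h₂₃ : ∀ T R, Commute (f₂ T) (f₃ R)) {ρ₁ : L →ₗ[ℝ] Op V₁} {ρ₂ : L →ₗ[ℝ] Op V₂}
    (hl₁ : ∀ y z, ρ₁ ⁅y, z⁆ = ρ₁ y * ρ₁ z - ρ₁ z * ρ₁ y)
    (hl₂ : ∀ y z, ρ₂ ⁅y, z⁆ = ρ₂ y * ρ₂ z - ρ₂ z * ρ₂ y) (s : CliffordStarRep L c S) :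
    Commute (-∑ k, f₂ (ρ₂ (x k)) * f₃ (s.gamma (x k)))
      (-∑ k, f₂ (ρ₂ (x k)) * f₃ (s.spin x (x k))) ∧
    Commute (-∑ k, f₁ (ρ₁ (x k)) * f₃ (s.gamma (x k)) +
      -∑ k, f₂ (ρ₂ (x k)) * f₃ (s.gamma (x k))) (-∑ k, f₁ (ρ₁ (x k)) * f₂ (ρ₂ (x k))) ∧
    Commute (-∑ k, f₁ (ρ₁ (x k)) * f₃ (s.gamma (x k)))
      (-∑ k, f₁ (ρ₁ (x k)) * f₂ (ρ₂ (x k)) + -∑ k, f₂ (ρ₂ (x k)) * f₃ (s.spin x (x k))) := by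
  have hskew := adSkew_of_invForm hx
  have hP := transport_lie f₁ hl₁
  have hQ := transport_lie f₂ hl₂
  have hg : ∀ y z, transport f₃ s.gamma y * transport f₃ s.gamma z +
      transport f₃ s.gamma z * transport f₃ s.gamma y = (2 * basisForm x y z) • 1 := fun y z => by
    simp only [transport_apply, ← map_mul, ← map_add, gamma_mul_gamma_add hx]
    rw [algHom_map_real_smul, map_one]
  have hσ : ∀ y, (4 : ℝ) • transport f₃ (s.spin x) y =
      ∑ k, transport f₃ s.gamma (x k) * transport f₃ s.gamma ⁅y, x k⁆ := fun y => by
    simp only [transport_apply, ← map_mul, ← map_sum, ← four_smul_spin]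
    exact (algHom_map_real_smul f₃ _ _).symm
  have hσg := hskew.clifford_commutator hg hσ
  simp only [← transport_apply, ← neg_add]
  exact ⟨(hskew.commute_dirac hQ hg hσ fun _ _ => h₂₃ _ _).neg_left.neg_right,
    (hskew.commute_add hP hQ (fun _ _ => h₁₂ _ _) (fun _ _ => h₁₃ _ _)
      fun _ _ => h₂₃ _ _).neg_left.neg_right,
    (hskew.commute_outer hP hσg (fun _ _ => h₁₂ _ _) (fun _ _ => h₁₃ _ _) (fun _ _ => h₂₃ _ _)
      fun _ _ => h₁₃ _ _).neg_left.neg_right⟩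

end Transport

section Abstract

open KZ

variable {V₁ V₂ S : Type*} [NormedAddCommGroup V₁] [InnerProductSpace ℂ V₁]
  [FiniteDimensional ℂ V₁] [NormedAddCommGroup V₂] [InnerProductSpace ℂ V₂]
  [FiniteDimensional ℂ V₂] [NormedAddCommGroup S] [InnerProductSpace ℂ S]
  [FiniteDimensional ℂ S]
  {L : Type*} [LieRing L] [LieAlgebra ℝ L] {κ : Type*} [Fintype κ]
  {x : Module.Basis κ ℝ L} {c : ℝ}

lemma star_hbar (q : ℝ) : star (hbar q) = -hbar q := by
  rw [hbar]
  simp only [Complex.star_def, map_div₀, map_mul, Complex.conj_ofReal, Complex.conj_I]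
  rw [mul_neg, div_neg]

lemma isSelfAdjoint_tElt {ρ₁ : L →ₗ[ℝ] Op V₁} {ρ₂ : L →ₗ[ℝ] Op V₂}
    (h₁ : ∀ y, star (ρ₁ y) = -ρ₁ y) (h₂ : ∀ y, star (ρ₂ y) = -ρ₂ y) :
    IsSelfAdjoint (tElt x ρ₁ ρ₂) :=
  isSelfAdjoint_neg_sum_mul
    (T := fun k => rTensorHom V₁ V₂ (ρ₁ (x k))) (R := fun k => lTensorHom V₁ V₂ (ρ₂ (x k)))
    (fun k => by rw [star_rTensorHom, h₁, map_neg])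
    (fun k => by rw [star_lTensorHom, h₂, map_neg])
    fun k => commute_rTensorHom_lTensorHom _ _

lemma isSelfAdjoint_t12 {ρ₁ : L →ₗ[ℝ] Op V₁} {ρ₂ : L →ₗ[ℝ] Op V₂}
    (h₁ : ∀ y, star (ρ₁ y) = -ρ₁ y) (h₂ : ∀ y, star (ρ₂ y) = -ρ₂ y) :
    IsSelfAdjoint (t12 S x ρ₁ ρ₂) := by
  rw [t12_eq]
  refine isSelfAdjoint_neg_sum_mul (fun k => ?_) (fun k => ?_) fun k => commute_leg₁_leg₂ _ _
  · rw [leg₁, star_rTensorHom, h₁, map_neg]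
  · rw [leg₂, AlgHom.comp_apply, star_lTensorHom, star_rTensorHom, h₂, map_neg, map_neg]

lemma isSelfAdjoint_t23 {ρ₂ : L →ₗ[ℝ] Op V₂} {ρ₃ : L →ₗ[ℝ] Op S}
    (h₂ : ∀ y, star (ρ₂ y) = -ρ₂ y) (h₃ : ∀ y, star (ρ₃ y) = -ρ₃ y) :
    IsSelfAdjoint (t23 V₁ x ρ₂ ρ₃) := by
  rw [IsSelfAdjoint, t23, mapL_id_left, star_lTensorHom, (isSelfAdjoint_tElt h₂ h₃).star_eq]

/-- Existence, uniqueness and the commutator estimate, for two representations of a Lie algebra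
by skew-adjoint operators and the spin representation. -/
theorem associator_spin [DecidableEq κ]
    (hx : ∀ k l, invForm L c (incl (x k)) (incl (x l)) = if k = l then -1 else 0)
    {ρ₁ : L →ₗ[ℝ] Op V₁} {ρ₂ : L →ₗ[ℝ] Op V₂}
    (h₁ : ∀ y, star (ρ₁ y) = -ρ₁ y) (h₂ : ∀ y, star (ρ₂ y) = -ρ₂ y)
    (hl₁ : ∀ y z, ρ₁ ⁅y, z⁆ = ρ₁ y * ρ₁ z - ρ₁ z * ρ₁ y)
    (hl₂ : ∀ y z, ρ₂ ⁅y, z⁆ = ρ₂ y * ρ₂ z - ρ₂ z * ρ₂ y)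
    (q : ℝ) (s : CliffordStarRep L c S) :
    (∃! Φ, IsDrinfeldAssociator q x ρ₁ ρ₂ (s.spin x) Φ) ∧
    ∀ Φ, IsDrinfeldAssociator q x ρ₁ ρ₂ (s.spin x) Φ →
      ‖t23 V₁ x ρ₂ s.gamma * Φ - Φ * t23 V₁ x ρ₂ s.gamma‖ ≤ 2 * ‖tElt x ρ₁ s.gamma‖ := by
  have hA : IsSelfAdjoint (t12 S x ρ₁ ρ₂) := isSelfAdjoint_t12 h₁ h₂
  have hB : IsSelfAdjoint (t23 V₁ x ρ₂ (s.spin x)) := isSelfAdjoint_t23 h₂ (star_spin hx s)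
  refine ⟨existsUnique_isKZAssociator (star_hbar q) hA hB, fun Φ hΦ => ?_⟩
  obtain ⟨hDB, hDEA, hE⟩ := commute_relations hx (leg₁ V₁ V₂ S) (leg₂ V₁ V₂ S) (leg₃ V₁ V₂ S)
    commute_leg₁_leg₂ commute_leg₁_leg₃ commute_leg₂_leg₃ hl₁ hl₂ s
  rw [← t23_eq, ← t23_eq] at hDB
  rw [← t12_eq, ← t23_eq] at hDEA hE
  refine (norm_commutator_associator_le (star_hbar q) hA hB hDB hDEA hE hΦ).trans ?_
  rw [norm_neg]
  exact mul_le_mul_of_nonneg_left (norm_t13_le x ρ₁ s.gamma) zero_le_two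

end Abstract

/-! ### Smoothness of continuous homomorphisms -/

section Smooth

open Filter Topology MeasureTheory

variable {n : ℕ} {G : Type*} [Group G] [TopologicalSpace G]
  [ChartedSpace (EuclideanSpace ℝ (Fin n)) G] [LieGroup (𝓡 n) ∞ G]
  {A : Type*} [NormedRing A] [NormedAlgebra ℝ A]

/-- The group homomorphism `f` read in the chart at the identity. -/
def chartHom (f : G →* A) (u : EuclideanSpace ℝ (Fin n)) : A := f ((extChartAt (𝓡 n) (1 : G)).symm u)

lemma contMDiffOn_chart_inv_mul :
    ContMDiffOn ((𝓡 n).prod (𝓡 n)) (𝓡 n) ∞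
      (fun p : EuclideanSpace ℝ (Fin n) × G => ((extChartAt (𝓡 n) (1 : G)).symm p.1)⁻¹ * p.2)
      ((extChartAt (𝓡 n) (1 : G)).target ×ˢ Set.univ) := by
  have h1 : ContMDiffOn ((𝓡 n).prod (𝓡 n)) (𝓡 n) ∞
      (fun p : EuclideanSpace ℝ (Fin n) × G => (extChartAt (𝓡 n) (1 : G)).symm p.1)
      ((extChartAt (𝓡 n) (1 : G)).target ×ˢ Set.univ) :=
    (contMDiffOn_extChartAt_symm (1 : G)).comp contMDiffOn_fst fun p hp => hp.1
  exact h1.inv.mul contMDiffOn_snd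

/-- For a smooth function `χ` on a compact Lie group, the derivative of `u ↦ χ (u⁻¹ h)` in chart
coordinates near the identity exists and is jointly continuous in `u` and `h`. -/
lemma exists_continuousOn_deriv {χ : G → ℝ} (hχ : ContMDiff (𝓡 n) 𝓘(ℝ, ℝ) ∞ χ) :
    ∃ D : EuclideanSpace ℝ (Fin n) × G → EuclideanSpace ℝ (Fin n) →L[ℝ] ℝ,
      ContinuousOn D ((extChartAt (𝓡 n) (1 : G)).target ×ˢ Set.univ) ∧
      ∀ u ∈ (extChartAt (𝓡 n) (1 : G)).target, ∀ h : G,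
        HasFDerivAt (fun v => χ (((extChartAt (𝓡 n) (1 : G)).symm v)⁻¹ * h)) (D (u, h)) u := by
  set T := (extChartAt (𝓡 n) (1 : G)).target with hT
  have hTo : IsOpen T := isOpen_extChartAt_target (1 : G)
  set k : EuclideanSpace ℝ (Fin n) × G → ℝ :=
    fun p => χ (((extChartAt (𝓡 n) (1 : G)).symm p.1)⁻¹ * p.2) with hk
  have hks : ContMDiffOn ((𝓡 n).prod (𝓡 n)) 𝓘(ℝ, ℝ) ∞ k (T ×ˢ Set.univ) :=
    hχ.comp_contMDiffOn contMDiffOn_chart_inv_mul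
  have hnhds : ∀ p ∈ T ×ˢ (Set.univ : Set G), T ×ˢ (Set.univ : Set G) ∈ 𝓝 p := fun p hp =>
    (hTo.prod isOpen_univ).mem_nhds hp
  refine ⟨fun p => fderiv ℝ (fun v => k (v, p.2)) p.1, fun p hp => ?_, fun u hu h => ?_⟩
  · have hf : ContMDiffAt (((𝓡 n).prod (𝓡 n)).prod (𝓡 n)) 𝓘(ℝ, ℝ) ∞
        (Function.uncurry fun (p : EuclideanSpace ℝ (Fin n) × G) (v : EuclideanSpace ℝ (Fin n)) =>
          k (v, p.2)) (p, p.1) := by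
      have h1 : ContMDiffAt (((𝓡 n).prod (𝓡 n)).prod (𝓡 n)) ((𝓡 n).prod (𝓡 n)) ∞
          (fun r : (EuclideanSpace ℝ (Fin n) × G) × EuclideanSpace ℝ (Fin n) => (r.2, r.1.2))
          (p, p.1) :=
        contMDiffAt_snd.prodMk (contMDiffAt_snd.comp _ contMDiffAt_fst)
      exact ContMDiffAt.comp (p, p.1) (hks.contMDiffAt (hnhds p hp)) h1
    have h := ContMDiffAt.mfderiv (m := 0) _ (fun p : EuclideanSpace ℝ (Fin n) × G => p.1) hf
      contMDiffAt_fst (by simp)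
    have e : inTangentCoordinates (𝓡 n) 𝓘(ℝ, ℝ) (fun q : EuclideanSpace ℝ (Fin n) × G => q.1)
        (fun q => k (q.1, q.2)) (fun q => mfderiv (𝓡 n) 𝓘(ℝ, ℝ) (fun v => k (v, q.2)) q.1) p =
        fun q => fderiv ℝ (fun v => k (v, q.2)) q.1 := by
      refine (inTangentCoordinates_model_space _ _ _ _).trans ?_
      simp only [mfderiv_eq_fderiv]
    rw [e] at h
    exact h.continuousAt.continuousWithinAt
  · have h1 : ContMDiffAt (𝓡 n) ((𝓡 n).prod (𝓡 n)) ∞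
        (fun v : EuclideanSpace ℝ (Fin n) => (v, h)) u := contMDiffAt_id.prodMk contMDiffAt_const
    have h2 : ContMDiffAt (𝓡 n) 𝓘(ℝ, ℝ) ∞ (fun v => k (v, h)) u :=
      ContMDiffAt.comp (g := k) u (hks.contMDiffAt (hnhds (u, h) ⟨hu, trivial⟩)) h1
    exact (h2.contDiffAt.differentiableAt (by simp)).hasFDerivAt

/-- A continuous homomorphism from a compact Lie group to a Banach algebra is differentiable at
the identity: averaging it against a smooth approximation of the identity multiplies it by an
invertible element and makes it differentiable. -/
lemma differentiableAt_chartHom [T2Space G] [CompactSpace G] [CompleteSpace A] {f : G →* A}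
    (hf : Continuous f) :
    DifferentiableAt ℝ (chartHom f) (extChartAt (𝓡 n) (1 : G) 1) := by
  have : IsTopologicalGroup G := topologicalGroup_of_lieGroup (𝓡 n) ∞
  have : SecondCountableTopology G :=
    ChartedSpace.secondCountable_of_sigmaCompact (EuclideanSpace ℝ (Fin n)) G
  let _ : MeasurableSpace G := borel G
  have : BorelSpace G := ⟨rfl⟩
  set μ : Measure G := Measure.haar
  have hint : ∀ {g : G → A}, Continuous g → Integrable g μ :=
    fun hg => hg.integrable_of_hasCompactSupport (HasCompactSupport.of_compactSpace _)
  have hnear : ∀ᶠ g in 𝓝 (1 : G), ‖f g - 1‖ < 1 / 2 := by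
    have h : Tendsto (fun g => ‖f g - 1‖) (𝓝 1) (𝓝 0) := by
      have h := ((hf.tendsto 1).sub_const 1).norm
      simpa using h
    exact h.eventually_lt_const (by norm_num)
  obtain ⟨χ, -, hχ⟩ := (SmoothBumpFunction.nhds_basis_tsupport (I := 𝓡 n) (1 : G)).mem_iff.mp hnear
  set C : A := ∫ h, χ h • f h ∂μ with hC
  set m : ℝ := ∫ h, χ h ∂μ with hm
  have hm0 : 0 < m := χ.continuous.integral_pos_of_hasCompactSupport_nonneg_nonzero
    (HasCompactSupport.of_compactSpace _) (fun _ => χ.nonneg) (x := 1) (by simp)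
  -- the average of `f` is invertible, as the bump function is supported where `f` is close to `1`
  have hunit : IsUnit C := by
    have h1 : C - m • (1 : A) = ∫ h, χ h • (f h - 1) ∂μ := by
      rw [hC, hm, ← integral_smul_const, ← integral_sub (f := fun h => χ h • f h)
        (g := fun h => χ h • (1 : A)) (hint (χ.continuous.smul hf))
        (hint (χ.continuous.smul continuous_const))]
      simp only [smul_sub]
    have h2 : ‖C - m • (1 : A)‖ ≤ m * (1 / 2) := by
      rw [h1, hm, ← integral_mul_const]
      refine (norm_integral_le_integral_norm _).trans (integral_mono
        (hint (χ.continuous.smul (hf.sub continuous_const))).norm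
        ((χ.continuous.mul continuous_const).integrable_of_hasCompactSupport
          (HasCompactSupport.of_compactSpace _)) fun h => ?_)
      simp only [norm_smul, Real.norm_of_nonneg χ.nonneg]
      by_cases hh : h ∈ tsupport χ
      · exact mul_le_mul_of_nonneg_left (le_of_lt (hχ hh)) χ.nonneg
      · simp [image_eq_zero_of_notMem_tsupport hh]
    have h3 : IsUnit (1 - (1 - m⁻¹ • C)) := by
      refine isUnit_one_sub_of_norm_lt_one ?_
      have h4 : 1 - m⁻¹ • C = -(m⁻¹ • (C - m • (1 : A))) := by
        rw [smul_sub, smul_smul, inv_mul_cancel₀ hm0.ne', one_smul, neg_sub]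
      rw [h4, norm_neg, norm_smul, norm_inv, Real.norm_of_nonneg hm0.le]
      calc m⁻¹ * ‖C - m • (1 : A)‖ ≤ m⁻¹ * (m * (1 / 2)) := by gcongr
        _ < 1 := by
          rw [inv_mul_cancel_left₀ hm0.ne']
          norm_num
    rw [sub_sub_cancel] at h3
    have h5 : C = algebraMap ℝ A m * (m⁻¹ • C) := by
      rw [← Algebra.smul_def, smul_smul, mul_inv_cancel₀ hm0.ne', one_smul]
    rw [h5]
    exact ((isUnit_iff_ne_zero.mpr hm0.ne').map (algebraMap ℝ A)).mul h3
  obtain ⟨D, hD, hD'⟩ := exists_continuousOn_deriv χ.contMDiff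
  set e := extChartAt (𝓡 n) (1 : G) with he
  have hT : e.target ∈ 𝓝 (e 1) := extChartAt_target_mem_nhds (1 : G)
  obtain ⟨r, hr, hball⟩ := Metric.nhds_basis_closedBall.mem_iff.mp hT
  obtain ⟨M, hM⟩ := ((isCompact_closedBall (e 1) r).prod isCompact_univ).exists_bound_of_continuousOn
    (hD.mono (Set.prod_mono hball subset_rfl))
  obtain ⟨M', hM'⟩ := isCompact_univ.exists_bound_of_continuousOn hf.continuousOn
  have hkey : DifferentiableAt ℝ (fun u => ∫ h, χ ((e.symm u)⁻¹ * h) • f h ∂μ) (e 1) := by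
    refine (hasFDerivAt_integral_of_dominated_of_fderiv_le
      (F' := fun u h => (D (u, h)).smulRight (f h)) (bound := fun _ => M * M')
      (Metric.closedBall_mem_nhds (e 1) hr) (Eventually.of_forall fun u => ?_) ?_ ?_
      (Eventually.of_forall fun h u hu => ?_) (integrable_const _)
      (Eventually.of_forall fun h u hu => ?_)).differentiableAt
    · exact (hint ((χ.continuous.comp (continuous_const.mul continuous_id)).smul
        hf)).aestronglyMeasurable
    · exact hint ((χ.continuous.comp (continuous_const.mul continuous_id)).smul hf)
    · have : SecondCountableTopologyEither G (EuclideanSpace ℝ (Fin n) →L[ℝ] A) :=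
        secondCountableTopologyEither_of_left _ _
      refine Continuous.aestronglyMeasurable ?_
      have hD1 : Continuous fun h : G => D (e 1, h) := by
        refine continuousOn_univ.mp (hD.comp (by fun_prop) fun h _ => ⟨?_, trivial⟩)
        exact mem_of_mem_nhds hT
      exact (ContinuousLinearMap.smulRightL ℝ _ A).continuous₂.comp (hD1.prodMk hf)
    · rw [ContinuousLinearMap.norm_smulRight_apply]
      exact mul_le_mul (hM (u, h) ⟨hu, trivial⟩) (hM' h trivial) (norm_nonneg _)
        ((norm_nonneg _).trans (hM (u, h) ⟨hu, trivial⟩))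
    · exact (hD' u (hball hu) h).smul_const (f h)
  have hconv : (fun u => ∫ h, χ ((e.symm u)⁻¹ * h) • f h ∂μ) = fun u => chartHom f u * C := by
    ext u
    rw [← integral_mul_left_eq_self _ (e.symm u)]
    simp only [inv_mul_cancel_left, map_mul, ← mul_smul_comm]
    rw [hC]
    exact integral_const_mul_of_integrable (hint (χ.continuous.smul hf))
  rw [hconv] at hkey
  obtain ⟨c, hc⟩ := hunit
  have : chartHom f = fun u : EuclideanSpace ℝ (Fin n) => chartHom f u * C * ↑c⁻¹ := by
    ext u
    rw [mul_assoc, ← hc, Units.mul_inv, mul_one]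
  rw [this]
  exact hkey.mul_const _

end Smooth

/-! ### The differential of a homomorphism -/

section Differential

open Filter Topology VectorField

variable {n : ℕ} {G : Type*} [Group G] [TopologicalSpace G]
  [ChartedSpace (EuclideanSpace ℝ (Fin n)) G] {A : Type*} [NormedRing A] {f : G →* A}

variable (G) in
/-- Left division in the chart at the identity: `(u, v) ↦ u⁻¹ v`. -/
def chartDiv (u v : EuclideanSpace ℝ (Fin n)) : EuclideanSpace ℝ (Fin n) :=
  extChartAt (𝓡 n) (1 : G) (((extChartAt (𝓡 n) (1 : G)).symm u)⁻¹ *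
    (extChartAt (𝓡 n) (1 : G)).symm v)

lemma chartDiv_self (u : EuclideanSpace ℝ (Fin n)) :
    chartDiv G u u = extChartAt (𝓡 n) (1 : G) 1 := by
  rw [chartDiv, inv_mul_cancel]

lemma continuousOn_chartHom (hf : Continuous f) :
    ContinuousOn (chartHom f) (extChartAt (𝓡 n) (1 : G)).target :=
  hf.comp_continuousOn (continuousOn_extChartAt_symm (1 : G))

variable [LieGroup (𝓡 n) ∞ G]

lemma contDiffAt_chartDiv {u : EuclideanSpace ℝ (Fin n)}
    (hu : u ∈ (extChartAt (𝓡 n) (1 : G)).target) :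
    ContDiffAt ℝ ∞ (Function.uncurry (chartDiv G)) (u, u) := by
  set e := extChartAt (𝓡 n) (1 : G) with he
  have hT : e.target ∈ 𝓝 u := (isOpen_extChartAt_target (1 : G)).mem_nhds hu
  have hs : ContMDiffAt (𝓡 n) (𝓡 n) ∞ e.symm u := (contMDiffOn_extChartAt_symm (1 : G)).contMDiffAt hT
  have h1 : ContMDiffAt 𝓘(ℝ, EuclideanSpace ℝ (Fin n) × EuclideanSpace ℝ (Fin n)) (𝓡 n) ∞
      (fun p : EuclideanSpace ℝ (Fin n) × EuclideanSpace ℝ (Fin n) => e.symm p.1) (u, u) :=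
    ContMDiffAt.comp (g := e.symm) (u, u) hs contDiffAt_fst.contMDiffAt
  have h2 : ContMDiffAt 𝓘(ℝ, EuclideanSpace ℝ (Fin n) × EuclideanSpace ℝ (Fin n)) (𝓡 n) ∞
      (fun p : EuclideanSpace ℝ (Fin n) × EuclideanSpace ℝ (Fin n) => e.symm p.2) (u, u) :=
    ContMDiffAt.comp (g := e.symm) (u, u) hs contDiffAt_snd.contMDiffAt
  have h3 : ContMDiffAt (𝓡 n) (𝓡 n) ∞ e ((e.symm u)⁻¹ * e.symm u) := by
    rw [inv_mul_cancel]
    exact contMDiffAt_extChartAt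
  exact (ContMDiffAt.comp (g := e) (u, u) h3 (h1.inv.mul h2)).contDiffAt

lemma eventually_chartHom_eq_mul {u : EuclideanSpace ℝ (Fin n)}
    (hu : u ∈ (extChartAt (𝓡 n) (1 : G)).target) :
    ∀ᶠ v in 𝓝 u, chartHom f v = chartHom f u * chartHom f (chartDiv G u v) := by
  have : IsTopologicalGroup G := topologicalGroup_of_lieGroup (𝓡 n) ∞
  set e := extChartAt (𝓡 n) (1 : G) with he
  have hc : ContinuousAt (fun v => (e.symm u)⁻¹ * e.symm v) u :=
    continuousAt_const.mul (continuousAt_extChartAt_symm'' hu)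
  have hs : e.source ∈ 𝓝 ((e.symm u)⁻¹ * e.symm u) := by
    rw [inv_mul_cancel]
    exact extChartAt_source_mem_nhds (1 : G)
  filter_upwards [hc hs] with v hv
  rw [chartHom, chartHom, chartHom, chartDiv, ← he, e.left_inv hv, map_mul, ← mul_assoc, ← map_mul,
    mul_inv_cancel, map_one, one_mul]

variable [NormedAlgebra ℝ A]

/-- The logarithmic derivative of a homomorphism is determined by the group law. -/
lemma hasFDerivAt_chartHom
    (hf : DifferentiableAt ℝ (chartHom f) (extChartAt (𝓡 n) (1 : G) 1))
    {u : EuclideanSpace ℝ (Fin n)} (hu : u ∈ (extChartAt (𝓡 n) (1 : G)).target) :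
    HasFDerivAt (chartHom f) ((ContinuousLinearMap.mul ℝ A (chartHom f u)).comp
      ((fderiv ℝ (chartHom f) (extChartAt (𝓡 n) (1 : G) 1)).comp (fderiv ℝ (chartDiv G u) u))) u := by
  have h1 : HasFDerivAt (chartDiv G u) (fderiv ℝ (chartDiv G u) u) u := by
    have h := (contDiffAt_chartDiv hu).comp u (contDiffAt_const.prodMk contDiffAt_id :
      ContDiffAt ℝ ∞ (fun v : EuclideanSpace ℝ (Fin n) => (u, v)) u)
    exact (h.differentiableAt (by simp)).hasFDerivAt
  have h2 := hf.hasFDerivAt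
  rw [← chartDiv_self u] at h2
  refine HasFDerivAt.congr_of_eventuallyEq ?_ (eventually_chartHom_eq_mul hu)
  rw [← chartDiv_self u]
  exact (ContinuousLinearMap.mul ℝ A (chartHom f u)).hasFDerivAt.comp u (h2.comp u h1)

/-- Bootstrapping: the formula for the derivative shows that a continuous homomorphism that is
differentiable at the identity is twice continuously differentiable. -/
lemma contDiffAt_chartHom (hc : Continuous f)
    (hf : DifferentiableAt ℝ (chartHom f) (extChartAt (𝓡 n) (1 : G) 1)) :
    ContDiffAt ℝ 2 (chartHom f) (extChartAt (𝓡 n) (1 : G) 1) := by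
  set e := extChartAt (𝓡 n) (1 : G) with he
  have hT : e.target ∈ 𝓝 (e 1) := extChartAt_target_mem_nhds (1 : G)
  have hκ : ContDiffAt ℝ 1 (fun u => fderiv ℝ (chartDiv G u) u) (e 1) :=
    ContDiffAt.fderiv (n := ∞) (g := id) (contDiffAt_chartDiv (mem_of_mem_nhds hT)) contDiffAt_id
      (by norm_cast)
  have hstep : ∀ m : ℕ, m ≤ 1 → ContDiffAt ℝ m (chartHom f) (e 1) →
      ContDiffAt ℝ (m + 1) (chartHom f) (e 1) := fun m hm hφ => by
    refine contDiffAt_succ_iff_hasFDerivAt.mpr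
      ⟨_, ⟨e.target, hT, fun u hu => hasFDerivAt_chartHom hf hu⟩, ?_⟩
    have h1 : ContDiffAt ℝ m (fun u => ContinuousLinearMap.mul ℝ A (chartHom f u)) (e 1) :=
      (ContinuousLinearMap.mul ℝ A).contDiff.contDiffAt.comp _ hφ
    exact h1.clm_comp (contDiffAt_const.clm_comp (hκ.of_le (by exact_mod_cast hm)))
  have h0 : ContDiffAt ℝ (0 : ℕ) (chartHom f) (e 1) :=
    contDiffAt_zero.mpr ⟨e.target, hT, continuousOn_chartHom hc⟩
  have h1 := hstep 0 zero_le_one h0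
  have h2 := hstep 1 le_rfl (by exact_mod_cast h1)
  exact_mod_cast h2

lemma hasMFDerivAt_one_of_chartHom
    (hf : DifferentiableAt ℝ (chartHom f) (extChartAt (𝓡 n) (1 : G) 1)) :
    HasMFDerivAt (𝓡 n) 𝓘(ℝ, A) f 1 ((fderiv ℝ (chartHom f) (extChartAt (𝓡 n) (1 : G) 1)).comp
      (mfderiv (𝓡 n) 𝓘(ℝ, EuclideanSpace ℝ (Fin n)) (extChartAt (𝓡 n) (1 : G)) 1)) := by
  have h1 : HasMFDerivAt (𝓡 n) 𝓘(ℝ, A) (chartHom f ∘ extChartAt (𝓡 n) (1 : G)) 1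
      ((fderiv ℝ (chartHom f) (extChartAt (𝓡 n) (1 : G) 1)).comp
        (mfderiv (𝓡 n) 𝓘(ℝ, EuclideanSpace ℝ (Fin n)) (extChartAt (𝓡 n) (1 : G)) 1)) :=
    HasMFDerivAt.comp 1 hf.hasFDerivAt.hasMFDerivAt
      (mdifferentiableAt_extChartAt (mem_chart_source _ _)).hasMFDerivAt
  refine h1.congr_of_eventuallyEq ?_
  filter_upwards [extChartAt_source_mem_nhds (I := 𝓡 n) (1 : G)] with g hg
  simp only [Function.comp_apply, chartHom]
  rw [(extChartAt (𝓡 n) (1 : G)).left_inv hg]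

/-- A homomorphism that is differentiable at the identity is differentiable. -/
lemma mdifferentiable_of_one (hf : MDifferentiableAt (𝓡 n) 𝓘(ℝ, A) f 1) (g : G) :
    MDifferentiableAt (𝓡 n) 𝓘(ℝ, A) f g := by
  have h1 : (f : G → A) = (fun a => f g * a) ∘ f ∘ fun h => g⁻¹ * h := by
    ext h
    simp [← map_mul]
  have h2 : MDifferentiableAt (𝓡 n) (𝓡 n) (fun h : G => g⁻¹ * h) g :=
    (contMDiff_mul_left (n := ∞)).contMDiffAt.mdifferentiableAt (by simp)
  have h3 : MDifferentiableAt (𝓡 n) 𝓘(ℝ, A) f (g⁻¹ * g) := by rwa [inv_mul_cancel]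
  rw [h1]
  refine MDifferentiableAt.comp (I' := 𝓘(ℝ, A)) g ?_ (MDifferentiableAt.comp g h3 h2)
  exact (ContinuousLinearMap.mul ℝ A (f g)).differentiableAt.mdifferentiableAt

/-- The differential at `g` of a map from a Lie group to a normed space, with values in that space. -/
def homDeriv (f : G → A) (g : G) : TangentSpace (𝓡 n) g →L[ℝ] A := mfderiv (𝓡 n) 𝓘(ℝ, A) f g

lemma homDeriv_mul_left (hf : MDifferentiableAt (𝓡 n) 𝓘(ℝ, A) f 1)
    (y : GroupLieAlgebra (𝓡 n) G) {g h : G} (hg : g * 1 = h) :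
    homDeriv f h (mfderiv (𝓡 n) (𝓡 n) (fun h : G => g * h) 1 y) = f g * homDeriv f 1 y := by
  subst hg
  have h1 : MDifferentiableAt (𝓡 n) (𝓡 n) (fun h : G => g * h) 1 :=
    (contMDiff_mul_left (n := ∞)).contMDiffAt.mdifferentiableAt (by simp)
  have h2 : MDifferentiableAt (𝓡 n) 𝓘(ℝ, A) f (g * 1) := mdifferentiable_of_one hf _
  have e1 : HasMFDerivAt (𝓡 n) 𝓘(ℝ, A) (f ∘ fun h => g * h) 1
      ((homDeriv f (g * 1)).comp (mfderiv (𝓡 n) (𝓡 n) (fun h : G => g * h) 1)) :=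
    HasMFDerivAt.comp 1 h2.hasMFDerivAt h1.hasMFDerivAt
  have e2 : (f ∘ fun h => g * h) = ContinuousLinearMap.mul ℝ A (f g) ∘ f := by
    ext h
    simp
  have e3 : HasMFDerivAt (𝓡 n) 𝓘(ℝ, A) (ContinuousLinearMap.mul ℝ A (f g) ∘ f) 1
      ((ContinuousLinearMap.mul ℝ A (f g)).comp (homDeriv f 1)) :=
    HasMFDerivAt.comp (I' := 𝓘(ℝ, A)) 1
      (ContinuousLinearMap.mul ℝ A (f g)).hasFDerivAt.hasMFDerivAt hf.hasMFDerivAt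
  rw [e2] at e1
  exact DFunLike.congr_fun (hasMFDerivAt_unique e1 e3) y

/-- A homomorphism intertwines left-invariant vector fields with right multiplication by the value
of its differential. -/
lemma homDeriv_mulInvariantVectorField (hf : MDifferentiableAt (𝓡 n) 𝓘(ℝ, A) f 1)
    (y : GroupLieAlgebra (𝓡 n) G) (g : G) :
    homDeriv f g (mulInvariantVectorField y g) = f g * homDeriv f 1 y :=
  homDeriv_mul_left hf y (mul_one g)

/-- The left-invariant vector field with value `y` at the identity, read in the chart there. -/
def chartField (y : GroupLieAlgebra (𝓡 n) G) (u : EuclideanSpace ℝ (Fin n)) :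
    EuclideanSpace ℝ (Fin n) :=
  mpullbackWithin 𝓘(ℝ, EuclideanSpace ℝ (Fin n)) (𝓡 n) (extChartAt (𝓡 n) (1 : G)).symm
    (mulInvariantVectorField y) (Set.range (𝓡 n)) u

lemma differentiableAt_chartField (y : GroupLieAlgebra (𝓡 n) G) :
    DifferentiableAt ℝ (chartField y) (extChartAt (𝓡 n) (1 : G) 1) := by
  have h := MDifferentiableWithinAt.differentiableWithinAt_mpullbackWithin_vectorField
    (mdifferentiableAt_mulInvariantVectorField (I := 𝓡 n) y (g := (1 : G))).mdifferentiableWithinAt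
    (s := Set.univ)
  rw [Set.preimage_univ, Set.univ_inter, ModelWithCorners.Boundaryless.range_eq_univ] at h
  rw [← differentiableWithinAt_univ]
  unfold chartField
  rw [ModelWithCorners.Boundaryless.range_eq_univ]
  exact h

lemma fderiv_chartHom_chartField (hf : MDifferentiableAt (𝓡 n) 𝓘(ℝ, A) f 1)
    (y : GroupLieAlgebra (𝓡 n) G) {u : EuclideanSpace ℝ (Fin n)}
    (hu : u ∈ (extChartAt (𝓡 n) (1 : G)).target) :
    fderiv ℝ (chartHom f) u (chartField y u) = chartHom f u * homDeriv f 1 y := by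
  set e := extChartAt (𝓡 n) (1 : G) with he
  have h1 := isInvertible_mfderivWithin_extChartAt_symm (I := 𝓡 n) (x := (1 : G)) hu
  have h2 : MDifferentiableWithinAt 𝓘(ℝ, EuclideanSpace ℝ (Fin n)) (𝓡 n) e.symm
    (Set.range (𝓡 n)) u := mdifferentiableWithinAt_extChartAt_symm hu
  have h3 : HasMFDerivWithinAt 𝓘(ℝ, EuclideanSpace ℝ (Fin n)) 𝓘(ℝ, A) (f ∘ e.symm)
      (Set.range (𝓡 n)) u ((homDeriv f (e.symm u)).comp
        (mfderivWithin 𝓘(ℝ, EuclideanSpace ℝ (Fin n)) (𝓡 n) e.symm (Set.range (𝓡 n)) u)) :=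
    HasMFDerivAt.comp_hasMFDerivWithinAt u (mdifferentiable_of_one hf _).hasMFDerivAt
      h2.hasMFDerivWithinAt
  have h4 : HasFDerivAt (chartHom f) ((homDeriv f (e.symm u)).comp
        (mfderivWithin 𝓘(ℝ, EuclideanSpace ℝ (Fin n)) (𝓡 n) e.symm (Set.range (𝓡 n)) u) :
        EuclideanSpace ℝ (Fin n) →L[ℝ] A) u := by
    have h5 := hasMFDerivWithinAt_iff_hasFDerivWithinAt.mp h3
    rw [← hasFDerivWithinAt_univ, ← ModelWithCorners.Boundaryless.range_eq_univ (I := 𝓡 n)]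
    exact h5
  rw [h4.fderiv]
  refine Eq.trans ?_ (homDeriv_mulInvariantVectorField hf y (e.symm u))
  exact congrArg (homDeriv f (e.symm u)) (h1.self_apply_inverse _)

/-- The differential of a homomorphism at the identity, in terms of its derivative in the chart. -/
lemma homDeriv_one_inverse (hf : DifferentiableAt ℝ (chartHom f) (extChartAt (𝓡 n) (1 : G) 1))
    (w : EuclideanSpace ℝ (Fin n)) :
    homDeriv f 1 ((mfderiv (𝓡 n) 𝓘(ℝ, EuclideanSpace ℝ (Fin n))
      (extChartAt (𝓡 n) (1 : G)) 1).inverse w) =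
      fderiv ℝ (chartHom f) (extChartAt (𝓡 n) (1 : G) 1) w := by
  have h1 := isInvertible_mfderiv_extChartAt (I := 𝓡 n) (mem_extChartAt_source (1 : G))
  refine (DFunLike.congr_fun (hasMFDerivAt_unique
    (hasMFDerivAt_one_of_chartHom hf).mdifferentiableAt.hasMFDerivAt
    (hasMFDerivAt_one_of_chartHom hf)) _).trans ?_
  exact congrArg (fderiv ℝ (chartHom f) (extChartAt (𝓡 n) (1 : G) 1)) (h1.self_apply_inverse w)

/-- The differential of a homomorphism respects brackets. -/
lemma homDeriv_lie (hc : Continuous f)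
    (hf : DifferentiableAt ℝ (chartHom f) (extChartAt (𝓡 n) (1 : G) 1))
    (y z : GroupLieAlgebra (𝓡 n) G) :
    homDeriv f 1 ⁅y, z⁆ = homDeriv f 1 y * homDeriv f 1 z - homDeriv f 1 z * homDeriv f 1 y := by
  set e := extChartAt (𝓡 n) (1 : G) with he
  have hm := (hasMFDerivAt_one_of_chartHom hf).mdifferentiableAt
  have hT : e.target ∈ 𝓝 (e 1) := extChartAt_target_mem_nhds (1 : G)
  have hφ : chartHom f (e 1) = 1 := by
    rw [chartHom, extChartAt_to_inv, map_one]
  have h1 : homDeriv f 1 ⁅y, z⁆ =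
      fderiv ℝ (chartHom f) (e 1) (lieBracket ℝ (chartField y) (chartField z) (e 1)) := by
    refine Eq.trans ?_ (homDeriv_one_inverse hf _)
    rw [GroupLieAlgebra.bracket_def, ← mlieBracketWithin_univ, mlieBracketWithin_apply,
      Set.preimage_univ, Set.univ_inter, ← lieBracketWithin_univ]
    conv_rhs => rw [← ModelWithCorners.Boundaryless.range_eq_univ (I := 𝓡 n)]
    rfl
  have h2 : ∀ y z : GroupLieAlgebra (𝓡 n) G,
      fderiv ℝ (fun u => fderiv ℝ (chartHom f) u (chartField z u)) (e 1) (chartField y (e 1)) =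
        homDeriv f 1 y * homDeriv f 1 z := fun y z => by
    have h3 : (fun u => fderiv ℝ (chartHom f) u (chartField z u)) =ᶠ[𝓝 (e 1)]
        fun u => chartHom f u * homDeriv f 1 z := by
      filter_upwards [hT] with u hu
      exact fderiv_chartHom_chartField hm z hu
    rw [h3.fderiv_eq, (hf.hasFDerivAt.mul_const' (homDeriv f 1 z)).fderiv]
    have h4 := fderiv_chartHom_chartField hm y (mem_of_mem_nhds hT)
    rw [hφ, one_mul] at h4
    simp [h4]
  rw [h1, fderiv_apply_lieBracket (n := 2) (contDiffAt_chartHom hc hf) (by simp)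
    (differentiableAt_chartField z) (differentiableAt_chartField y), h2, h2]

end Differential

/-! ### Differentials of unitary representations -/

section Unitary

open Filter Topology KZ

variable {n : ℕ} {G : Type*} [Group G] [TopologicalSpace G]
  [ChartedSpace (EuclideanSpace ℝ (Fin n)) G]
  {V : Type*} [NormedAddCommGroup V] [InnerProductSpace ℂ V]

/-- A unitary representation as a homomorphism to the multiplicative monoid of operators. -/
def KZ.UnitaryRep.opHom (π : UnitaryRep G V) : G →* Op V where
  toFun g := ((π.toHom g : V ≃L[ℂ] V) : V →L[ℂ] V)
  map_one' := by
    ext v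
    simp
  map_mul' g h := by
    ext v
    simp

lemma star_opHom_mul_self [CompleteSpace V] (π : UnitaryRep G V) (g : G) :
    star (π.opHom g) * π.opHom g = 1 := by
  refine ContinuousLinearMap.ext fun v => ext_inner_left ℂ fun w => ?_
  change inner ℂ w (ContinuousLinearMap.adjoint (π.opHom g) (π.opHom g v)) = inner ℂ w v
  rw [ContinuousLinearMap.adjoint_inner_right]
  exact (π.toHom g).inner_map_map w v

variable [LieGroup (𝓡 n) ∞ G]

/-- Differentiating `f(g)* f(g) = 1` at the identity. -/
lemma star_homDeriv {A : Type*} [NormedRing A] [NormedAlgebra ℝ A] [StarRing A] [StarModule ℝ A]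
    [ContinuousStar A] {f : G →* A} (hs : ∀ g, star (f g) * f g = 1)
    (hf : DifferentiableAt ℝ (chartHom f) (extChartAt (𝓡 n) (1 : G) 1))
    (y : GroupLieAlgebra (𝓡 n) G) : star (homDeriv f 1 y) = -homDeriv f 1 y := by
  set e := extChartAt (𝓡 n) (1 : G) with he
  have hφ : chartHom f (e 1) = 1 := by
    rw [chartHom, extChartAt_to_inv, map_one]
  have h1 := hf.hasFDerivAt.star.mul' hf.hasFDerivAt
  have h2 : (fun u => star (chartHom f u) * chartHom f u) =
      fun _ : EuclideanSpace ℝ (Fin n) => (1 : A) := funext fun u => hs _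
  have h3 := DFunLike.congr_fun (h1.unique (h2 ▸ hasFDerivAt_const (1 : A) (e 1)))
    (chartField y (e 1))
  have h4 := fderiv_chartHom_chartField (hasMFDerivAt_one_of_chartHom hf).mdifferentiableAt y
    (mem_extChartAt_target (I := 𝓡 n) (1 : G))
  rw [hφ, one_mul] at h4
  have h5 : star (fderiv ℝ (chartHom f) (e 1) (chartField y (e 1))) * chartHom f (e 1) +
      star (chartHom f (e 1)) * fderiv ℝ (chartHom f) (e 1) (chartField y (e 1)) = 0 := by
    simpa [add_comm] using h3
  rw [hφ, h4, star_one, mul_one, one_mul] at h5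
  exact eq_neg_of_add_eq_zero_left h5

variable [T2Space G] [CompactSpace G]

lemma differential_lie [CompleteSpace V] (π : UnitaryRep G V) (y z : GroupLieAlgebra (𝓡 n) G) :
    π.differential ⁅y, z⁆ =
      π.differential y * π.differential z - π.differential z * π.differential y :=
  homDeriv_lie (f := π.opHom) π.continuous_toHom (differentiableAt_chartHom π.continuous_toHom) y z

lemma star_differential [CompleteSpace V] (π : UnitaryRep G V) (y : GroupLieAlgebra (𝓡 n) G) :
    star (π.differential y) = -π.differential y :=
  star_homDeriv (f := π.opHom) (star_opHom_mul_self π)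
    (differentiableAt_chartHom π.continuous_toHom) y

end Unitary

end

theorem mainTheorem3 {n : ℕ} {G : Type*} [Group G] [TopologicalSpace G]
    [ChartedSpace (EuclideanSpace ℝ (Fin n)) G] [LieGroup (𝓡 n) ∞ G]
    [T2Space G] [CompactSpace G] [SimplyConnectedSpace G]
    [LieAlgebra.IsSimple ℝ (GroupLieAlgebra (𝓡 n) G)]
    (q : ℝ) (hq : q ∈ Set.Ioo (0 : ℝ) 1)
    (c : ℝ) (hc : KZ.IsNormalizingScale (GroupLieAlgebra (𝓡 n) G) c)
    {κ : Type*} [Fintype κ] [DecidableEq κ] (x : Module.Basis κ ℝ (GroupLieAlgebra (𝓡 n) G))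
    (hx : ∀ k l, KZ.invForm (GroupLieAlgebra (𝓡 n) G) c (KZ.incl (x k)) (KZ.incl (x l)) =
      if k = l then -1 else 0)
    {V : Type*} [NormedAddCommGroup V] [InnerProductSpace ℂ V] [FiniteDimensional ℂ V]
    (π : KZ.UnitaryRep G V)
    {V' : Type*} [NormedAddCommGroup V'] [InnerProductSpace ℂ V'] [FiniteDimensional ℂ V']
    (π' : KZ.UnitaryRep G V')
    {S : Type*} [NormedAddCommGroup S] [InnerProductSpace ℂ S] [FiniteDimensional ℂ S]
    (s : KZ.CliffordStarRep (GroupLieAlgebra (𝓡 n) G) c S) :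
    (∃! Φ, KZ.IsDrinfeldAssociator q x π.differential π'.differential (s.spin x) Φ) ∧
    ∀ Φ, KZ.IsDrinfeldAssociator q x π.differential π'.differential (s.spin x) Φ →
      ‖KZ.t23 V x π'.differential s.gamma * Φ - Φ * KZ.t23 V x π'.differential s.gamma‖ ≤
        6 * ‖KZ.tElt x π.differential s.gamma‖ := by
  have h := associator_spin hx (star_differential π) (star_differential π') (differential_lie π)
    (differential_lie π') q s
  refine ⟨h.1, fun Φ hΦ => (h.2 Φ hΦ).trans ?_⟩
  exact mul_le_mul_of_nonneg_right (by norm_num) (norm_nonneg _)
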